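/- Consider a mining game with an attacker. Blocks are found one after another; the times between consecutive blocks are independent exponential variables of rate $1/(1-\lambda)$, where $\lambda\in[0,1)$ (in particular, $\lambda$ may be the orphan rate of the game). Each block is found, independently, by the attacker with probability $\alpha\in[0,1/2)$ and by the honest miners otherwise. The reward is static: a block found a time $t$ after its parent carries a real random reward $R(t)$, whose law depends on $t$ only and which is drawn independently for each block; put $F_t(x)=\Pr[R(t)\le x]$. Assume that $(t,s)\mapsto R(t)(s)$ is measurable and that $R(T)$ has a finite mean when $T$ is an independent exponential time of rate $(1-\alpha)/(1-\lambda)$. Honest miners mine on the longest public chain and publish at once. The attacker follows the $\beta$-cutoff strategy ($\beta\in\mathbb R$), which gives the following states. - State $0$ (no hidden block): an attacker block with reward greater than $\beta$ is published at once (the state remains $0$) and one with reward at most $\beta$ is withheld (to State $1$); an honest block leaves the state at $0$. - State $i\ge1$ (hidden chain $i$ blocks longer than the public chain): an attacker block leads to State $i+1$. An honest block leads to State $i-1$ if $i\ge3$; for $i=2$ the attacker publishes the hidden chain, which is adopted (to State $0''$); for $i=1$ the attacker publishes and there are two competing forks of length one (to State $0'$). - State $0'$: the next block decides the race and leads to State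 $0$. The attacker mines on the attacker's fork; an honest block extends the attacker's fork with probability $\gamma\in[0,1]$ and the honest fork otherwise. - State $0''$: the next block, whoever finds it, extends the published chain and is published (to State $0$). Thus the state after each block is a Markov chain with transition probability $\alpha\int_0^\infty \frac{e^{-t/(1-\lambda)}}{1-\lambda}F_t(\beta)\,dt$ from $0$ to $1$, the complementary probability from $0$ to $0$, probabilities $\alpha$ and $1-\alpha$ for an attacker and an honest block in State $i\ge1$, and probability $1$ from $0'$ and $0''$ to $0$. A block is canonical if it lies on the public longest chain from some moment on. For $i\ge0$ let $f_i$ be the expected attacker reward of State $i$: start the game in State $i$ at the moment at which the block that the attacker mines on has just been found, and take the expectation of the reward of the canonical block found by the attacker with that block as its parent (counted as $0$ if there is no such block). Then the chain has a unique stationary distribution $p$, all the expectations involved are finite, the series below converges, and the attacker's expected reward per unit of time of the chain (one transition, that is, one block found) is $$V=f_0p_0+f_1p_1+\alpha\sum_{i=2}^\infty f_i\,p_{i-1}.$$ That is, if $G_n$ is the sum of the rewards of the canonical attacker blocks among the first $n$ blocks of the game started in State $0$ with a public genesis block, then $\mathbb E[G_n]/n\to V$. Consequently, if $T_n$ is the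 time at which the $n$-th block is found, $\mathbb E[G_n]/\mathbb E[T_n]\to V/(1-\lambda)$. -/

import Mathlib

open MeasureTheory ProbabilityTheory Filter Topology

noncomputable section

namespace SelfishMining

/-- The data of the game. `α` is the attacker's share of the mining power, `β` the cutoff, `γ` the
fraction of the honest miners that mine on the attacker's block during a race, and blocks are found
at rate `1 / (1 - lam)`. The reward is static: a block found a time `t` after its parent carries the
reward `R t s`, where `s` is a fresh sample of the law `ν`. -/
structure Model (S : Type*) [MeasurableSpace S] where
  α : ℝ
  β : ℝ
  γ : ℝ
  lam : ℝ
  R : ℝ → S → ℝ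
  ν : Measure S

/-- The states of the chain: `lead i` is State `i` (for `i = 0` no hidden block, for `i ≥ 1` the
hidden chain is `i` blocks longer than the public one), `race` is State `0'` (two public forks of
length one), and `reset` is State `0''` (the attacker has just published the hidden chain). -/
inductive State where
  | lead (i : ℕ)
  | race
  | reset
  deriving DecidableEq

/-! ### The game -/

/-- The randomness attached to one block: whether the attacker finds it; whether, in a race, an
honest finder of it mines on the attacker's fork; the time since the previous block was found (by
anybody); the seed of its reward. -/
abbrev Noise (S : Type*) := Bool × Bool × ℝ × S

/-- A coin that is `true` with probability `a`. -/
def coin (a : ℝ) : Measure Bool :=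
  ENNReal.ofReal a • Measure.dirac true + ENNReal.ofReal (1 - a) • Measure.dirac false

/-- Chains are lists of block numbers, newest block first. Honest miners mine on `publicChain`,
the attacker on `attackerChain`; the two agree in State `0` and State `0''`, and in State `0'` they
are the two competing public forks. -/
structure Config where
  state : State
  publicChain : List ℕ
  attackerChain : List ℕ

/-- The configuration after block `k` has been found. The flags say whether the attacker found it,
whether an honest finder mines on the attacker's fork in a race, and whether the reward is small
enough for the attacker to withhold the block in State `0`. -/
def step (c : Config) (k : ℕ) (byAttacker tie small : Bool) : Config :=
  match c.state, byAttacker with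
  | .lead 0, false => ⟨.lead 0, k :: c.publicChain, k :: c.publicChain⟩
  | .lead 0, true =>
      if small then ⟨.lead 1, c.publicChain, k :: c.attackerChain⟩
      else ⟨.lead 0, k :: c.attackerChain, k :: c.attackerChain⟩
  | .lead (i + 1), true => ⟨.lead (i + 2), c.publicChain, k :: c.attackerChain⟩
  | .lead 1, false => ⟨.race, k :: c.publicChain, c.attackerChain⟩
  -- the attacker publishes, the honest miners adopt the longer chain, block `k` is orphaned
  | .lead 2, false => ⟨.reset, c.attackerChain, c.attackerChain⟩
  | .lead (i + 3), false => ⟨.lead (i + 2), k :: c.publicChain, c.attackerChain⟩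
  | .race, true => ⟨.lead 0, k :: c.attackerChain, k :: c.attackerChain⟩
  | .race, false =>
      if tie then ⟨.lead 0, k :: c.attackerChain, k :: c.attackerChain⟩
      else ⟨.lead 0, k :: c.publicChain, k :: c.publicChain⟩
  | .reset, _ => ⟨.lead 0, k :: c.attackerChain, k :: c.attackerChain⟩

variable {S : Type*} [MeasurableSpace S]

namespace Model

variable (M : Model S)

/-- The law of the randomness of one block. -/
def noiseLaw : Measure (Noise S) :=
  (coin M.α).prod ((coin M.γ).prod ((expMeasure (1 / (1 - M.lam))).prod M.ν))

/-- The law of the whole game: the blocks have independent randomness. -/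
def law : Measure (ℕ → Noise S) := Measure.infinitePi fun _ => M.noiseLaw

/- In what follows the game starts in State `i`, at the moment at which the last block has just been
found: block `0` is public, blocks `1, …, i` form the hidden chain, and the block found with the
randomness `ω n` gets the number `i + n + 1`. The actual game is the one with `i = 0`. -/

/-- The time at which block `b` was found (the start of the game for `b ≤ i`). -/
def timestamp (i : ℕ) (ω : ℕ → Noise S) (b : ℕ) : ℝ :=
  ∑ j ∈ Finset.range (b - i), (ω j).2.2.1

/-- The block on which the attacker mines in configuration `c`. -/
def attackerTip (c : Config) : ℕ := c.attackerChain.headD 0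

/-- The reward in block `i + n + 1` if the attacker finds it in configuration `c`; it depends on the
time since the parent block. -/
def blockReward (i : ℕ) (ω : ℕ → Noise S) (c : Config) (n : ℕ) : ℝ :=
  M.R (timestamp i ω (i + n + 1) - timestamp i ω (attackerTip c)) (ω n).2.2.2

open scoped Classical in
/-- The configuration after `n` blocks have been found. -/
def config (i : ℕ) (ω : ℕ → Noise S) : ℕ → Config
  | 0 => ⟨.lead i, [0], (List.range (i + 1)).reverse⟩
  | n + 1 =>
      step (config i ω n) (i + n + 1) (ω n).1 (ω n).2.1
        (decide (M.blockReward i ω (config i ω n) n ≤ M.β))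

/-- Block `b` ends up on the eventual public longest chain. -/
def Canonical (i : ℕ) (ω : ℕ → Noise S) (b : ℕ) : Prop :=
  ∀ᶠ m in atTop, b ∈ (M.config i ω m).publicChain

open scoped Classical in
/-- What the attacker earns with block `i + n + 1`: its reward if the attacker found it and it is
canonical, and nothing otherwise. -/
def gain (i : ℕ) (ω : ℕ → Noise S) (n : ℕ) : ℝ :=
  if (ω n).1 = true ∧ M.Canonical i ω (i + n + 1) then
    M.blockReward i ω (M.config i ω n) n
  else 0

/-- The attacker's reward from the first `n` blocks of the game, which starts with a public genesis
block in State `0`. -/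
def totalReward (n : ℕ) (ω : ℕ → Noise S) : ℝ :=
  ∑ k ∈ Finset.range n, M.gain 0 ω k

open scoped Classical in
/-- For the game that starts in State `i`, where the attacker's tip is the block `i` just found:
what the attacker earns with the rewards that start to accrue in State `i`, that is, with the
canonical attacker block, if there is one, whose parent is that tip. -/
def stateReward (i : ℕ) (ω : ℕ → Noise S) : ℝ :=
  ∑' n, if attackerTip (M.config i ω n) = i then M.gain i ω n else 0

/-- The expected attacker reward `f_i` of State `i`. -/
def f (i : ℕ) : ℝ := ∫ ω, M.stateReward i ω ∂M.law

/-! ### The Markov chain -/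

/-- The distribution function `F_t(x)` of the reward a time `t` after the parent. -/
def F (t x : ℝ) : ℝ := M.ν.real {s | M.R t s ≤ x}

/-- The probability of the transition from State `0` to State `1`. -/
def withholdProb : ℝ :=
  M.α * ∫ t in Set.Ioi (0 : ℝ), Real.exp (-t / (1 - M.lam)) / (1 - M.lam) * M.F t M.β

/-- The probability that in State `0` the attacker finds a block and publishes it at once. -/
def publishProb : ℝ :=
  M.α * ∫ t in Set.Ioi (0 : ℝ), Real.exp (-t / (1 - M.lam)) / (1 - M.lam) * (1 - M.F t M.β)

/-- The transition probabilities of the `β`-cutoff Markov chain. -/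
def trans : State → State → ℝ
  | .lead 0, s =>
      if s = .lead 0 then (1 - M.α) + M.publishProb
      else if s = .lead 1 then M.withholdProb else 0
  | .lead 1, s => if s = .lead 2 then M.α else if s = .race then 1 - M.α else 0
  | .lead 2, s => if s = .lead 3 then M.α else if s = .reset then 1 - M.α else 0
  | .lead (i + 3), s =>
      if s = .lead (i + 4) then M.α else if s = .lead (i + 2) then 1 - M.α else 0
  | .race, s => if s = .lead 0 then 1 else 0
  | .reset, s => if s = .lead 0 then 1 else 0

/-- `p` is a stationary distribution of the chain. -/
structure IsStationary (p : State → ℝ) : Prop where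
  nonneg : ∀ s, 0 ≤ p s
  hasSum_one : HasSum p 1
  invariant : ∀ s, HasSum (fun s' => p s' * M.trans s' s) (p s)

end Model

end SelfishMining

end

noncomputable section

namespace SelfishMining

/-! ### Combinatorics of the game -/

open Model

/-! The reward is accounted for by parent. The number of the attacker's tip never decreases, so a
canonical attacker block has a well-defined parent `j`, which became the attacker's tip when block
`j` was found (or was the genesis block). At that moment the state is some `lead i`, and the tip is
called fresh (`Fresh i j`). From then on the game is, up to renumbering, a copy of the game started
in State `i` and driven by the shifted noise (`config_corresponds`). Hence the gain of a block
splits over fresh parents (`gain_eq_sum_tipGain`). As freshness depends on the first `j` blocks only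
and the shifted noise is independent of them, the expectation factors into `freshProb i j` times the
mean gain of a child found after a delay `m`; summed over `m` these means give `f i`.

It remains to find how often fresh tips of State `i` occur. States `0` and `1` always have a fresh
tip, which gives `p 0` and `p 1`. State `i + 2` is also reached by honest blocks, which leave the
tip old; a fresh tip there means an attacker block in State `i + 1`, with frequency `α * p (i + 1)`.
This explains the shape of `V`.

The frequencies exist by an ergodic theorem for Cesàro means (`tendsto_average`): the means are
asymptotically invariant, the balance equations force them to be asymptotically proportional to
`weight`, and a uniform geometric tail bound (`occupation_lead_le`) fixes the constant. The same
computation gives uniqueness of the stationary distribution.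

Limit and series are exchanged by dominated convergence. A child found after delay `m` requires `m`
honest blocks and then an attacker block, so its absolute reward is at most `firstReward`, whatever
`i` is. With the factor `ratio ^ m` from the geometric tail, the mean of `firstReward` carries `α ^
m` times an Erlang density. Summing these densities gives a multiple of the exponential density of
rate `(1 - α) / (1 - lam)`, so the assumed finite mean is what the domination needs
(`summable_bound`). -/

lemma attackerTip_step (c : Config) (k : ℕ) (x y z : Bool) :
    attackerTip (step c k x y z) = k ∨ attackerTip (step c k x y z) = attackerTip c := by
  rcases c with ⟨s, p, a⟩
  rcases s with (_ | _ | _ | i) | _ | _ <;> cases x <;> cases y <;> cases z <;>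
    simp [step, attackerTip]

lemma step_state_eq_lead_zero {c : Config} {k : ℕ} {x y z : Bool}
    (h : (step c k x y z).state = .lead 0) : attackerTip (step c k x y z) = k := by
  rcases c with ⟨s, p, a⟩
  revert h
  rcases s with (_ | _ | _ | i) | _ | _ <;> cases x <;> cases y <;> cases z <;>
    simp [step, attackerTip]

lemma step_state_eq_lead_one {c : Config} {k : ℕ} {x y z : Bool}
    (h : (step c k x y z).state = .lead 1) : attackerTip (step c k x y z) = k := by
  rcases c with ⟨s, p, a⟩
  revert h
  rcases s with (_ | _ | _ | i) | _ | _ <;> cases x <;> cases y <;> cases z <;>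
    simp [step, attackerTip]

/-- The moves into `race` and `reset` leave the attacker's chain unchanged, so a new tip excludes
both. -/
lemma step_state_of_attackerTip {c : Config} {k : ℕ} {x y z : Bool}
    (h : attackerTip (step c k x y z) = k) (hc : attackerTip c ≠ k) :
    ∃ i, (step c k x y z).state = .lead i := by
  rcases c with ⟨s, p, a⟩
  revert h hc
  rcases s with (_ | _ | _ | i) | _ | _ <;> cases x <;> cases y <;> cases z <;>
    simp +contextual [step, attackerTip]

/-- A lead of at least two can also arise from an honest block that shortens a longer lead, but then
the attacker's tip is an older block. -/
lemma step_state_eq_lead_add_two_iff {c : Config} {k i : ℕ} {x y z : Bool}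
    (hc : attackerTip c ≠ k) :
    (step c k x y z).state = .lead (i + 2) ∧ attackerTip (step c k x y z) = k ↔
      c.state = .lead (i + 1) ∧ x = true := by
  rcases c with ⟨s, p, a⟩
  revert hc
  rcases s with (_ | _ | _ | i) | _ | _ <;> cases x <;> cases y <;> cases z <;>
    simp +contextual [step, attackerTip]

lemma step_state_lead_le {c : Config} {k i n : ℕ} {x y z : Bool}
    (hc : ∀ i, c.state = .lead i → i ≤ n) (h : (step c k x y z).state = .lead i) : i ≤ n + 1 := by
  rcases c with ⟨s, p, a⟩
  revert hc h
  rcases s with (_ | _ | _ | i) | _ | _ <;> cases x <;> cases y <;> cases z <;>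
    simp +contextual [step] <;> omega

lemma step_mem_le {c : Config} {k : ℕ} {x y z : Bool}
    (hp : ∀ b ∈ c.publicChain, b < k) (ha : ∀ b ∈ c.attackerChain, b < k) :
    (∀ b ∈ (step c k x y z).publicChain, b < k + 1) ∧
      ∀ b ∈ (step c k x y z).attackerChain, b < k + 1 := by
  rcases c with ⟨s, p, a⟩
  have hp' : ∀ b ∈ p, b < k + 1 := fun b hb => (hp b hb).trans (Nat.lt_succ_self k)
  have ha' : ∀ b ∈ a, b < k + 1 := fun b hb => (ha b hb).trans (Nat.lt_succ_self k)
  rcases s with (_ | _ | _ | i) | _ | _ <;> cases x <;> cases y <;> cases z <;>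
    simp only [step, Bool.false_eq_true, if_true, if_false, List.forall_mem_cons] <;>
    refine ⟨?_, ?_⟩ <;> first | assumption | exact ⟨Nat.lt_succ_self k, ‹_›⟩

namespace Model

/-- The noise of the blocks after the first `j` ones. -/
def shift {S : Type*} (j : ℕ) (ω : ℕ → Noise S) : ℕ → Noise S := fun n => ω (n + j)

lemma timestamp_shift {S : Type*} (i j t : ℕ) (ω : ℕ → Noise S) :
    timestamp 0 ω (j + t) = timestamp 0 ω j + timestamp i (shift j ω) (i + t) := by
  simp [timestamp, shift, Finset.sum_range_add, add_comm]

end Model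

variable {S : Type*} [MeasurableSpace S] (M : Model S)

namespace Model

lemma attackerTip_config_zero (i : ℕ) (ω : ℕ → Noise S) : attackerTip (M.config i ω 0) = i := by
  simp [config, attackerTip, List.range_succ]

lemma attackerTip_config_bounds (i : ℕ) (ω : ℕ → Noise S) (n : ℕ) :
    i ≤ attackerTip (M.config i ω n) ∧ attackerTip (M.config i ω n) ≤ i + n := by
  induction n with
  | zero => simp [attackerTip_config_zero]
  | succ n ih =>
    rw [config]
    rcases attackerTip_step (M.config i ω n) (i + n + 1) (ω n).1 (ω n).2.1 _ with h | h <;>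
      rw [h] <;> omega

lemma attackerTip_config_ne (i : ℕ) (ω : ℕ → Noise S) (n : ℕ) :
    attackerTip (M.config i ω n) ≠ i + n + 1 := by
  have := M.attackerTip_config_bounds i ω n
  omega

/-- A step keeps the tip or replaces it by the newest block; an old tip therefore cannot reappear
after having been replaced. -/
lemma attackerTip_config_of_le {i : ℕ} {ω : ℕ → Noise S} {n m b : ℕ} (hb : b ≤ i + n)
    (h : attackerTip (M.config i ω (n + m)) = b) : attackerTip (M.config i ω n) = b := by
  induction m with
  | zero => exact h
  | succ m ih =>
    rw [← add_assoc, config] at h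
    rcases attackerTip_step (M.config i ω (n + m)) (i + (n + m) + 1) (ω (n + m)).1
      (ω (n + m)).2.1 _ with h' | h' <;> rw [h'] at h
    · omega
    · exact ih h

lemma config_mem_lt (i : ℕ) (ω : ℕ → Noise S) (n : ℕ) :
    (∀ b ∈ (M.config i ω n).publicChain, b < i + n + 1) ∧
      ∀ b ∈ (M.config i ω n).attackerChain, b < i + n + 1 := by
  induction n with
  | zero => simp [config]
  | succ n ih => exact step_mem_le ih.1 ih.2

lemma attackerTip_of_lead_zero {ω : ℕ → Noise S} {n : ℕ}
    (h : (M.config 0 ω n).state = .lead 0) : attackerTip (M.config 0 ω n) = n := by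
  cases n with
  | zero => exact M.attackerTip_config_zero 0 ω
  | succ n => exact (step_state_eq_lead_zero h).trans (by rw [zero_add])

lemma attackerTip_of_lead_one {ω : ℕ → Noise S} {n : ℕ}
    (h : (M.config 0 ω n).state = .lead 1) : attackerTip (M.config 0 ω n) = n := by
  cases n with
  | zero => exact M.attackerTip_config_zero 0 ω
  | succ n => exact (step_state_eq_lead_one h).trans (by rw [zero_add])

lemma lead_le {ω : ℕ → Noise S} {n i : ℕ} (h : (M.config 0 ω n).state = .lead i) : i ≤ n := by
  induction n generalizing i with
  | zero => simp [config] at h; omega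
  | succ n ih => exact step_state_lead_le (fun _ => ih) h

/-- After `j` blocks the attacker's tip is the block just found and the game is in State `i`. -/
def Fresh (i j : ℕ) (ω : ℕ → Noise S) : Prop :=
  (M.config 0 ω j).state = .lead i ∧ attackerTip (M.config 0 ω j) = j

lemma exists_fresh {ω : ℕ → Noise S} {j : ℕ} (h : attackerTip (M.config 0 ω j) = j) :
    ∃ i, M.Fresh i j ω := by
  cases j with
  | zero => exact ⟨0, rfl, h⟩
  | succ j =>
    obtain ⟨i, hi⟩ := step_state_of_attackerTip (by simpa [config] using h)
      (by simpa using M.attackerTip_config_ne 0 ω j)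
    exact ⟨i, by simpa [config] using hi, h⟩

lemma fresh_zero_iff {ω : ℕ → Noise S} {j : ℕ} :
    M.Fresh 0 j ω ↔ (M.config 0 ω j).state = .lead 0 :=
  ⟨And.left, fun h => ⟨h, M.attackerTip_of_lead_zero h⟩⟩

lemma fresh_one_iff {ω : ℕ → Noise S} {j : ℕ} :
    M.Fresh 1 j ω ↔ (M.config 0 ω j).state = .lead 1 :=
  ⟨And.left, fun h => ⟨h, M.attackerTip_of_lead_one h⟩⟩

lemma not_fresh_add_two_zero (i : ℕ) (ω : ℕ → Noise S) : ¬ M.Fresh (i + 2) 0 ω := by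
  simp [Fresh, config]

lemma fresh_add_two_succ_iff {i j : ℕ} {ω : ℕ → Noise S} :
    M.Fresh (i + 2) (j + 1) ω ↔ (M.config 0 ω j).state = .lead (i + 1) ∧ (ω j).1 = true := by
  have := step_state_eq_lead_add_two_iff (i := i) (x := (ω j).1) (y := (ω j).2.1)
    (z := (by classical exact decide (M.blockReward 0 ω (M.config 0 ω j) j ≤ M.β)))
    (M.attackerTip_config_ne 0 ω j)
  rw [← this, Fresh, config, zero_add]

end Model

/-- Two configurations agree up to renumbering the blocks after block `j` of the first one and
block `i` of the second one. -/
structure Corresponds (j i : ℕ) (c c' : Config) : Prop where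
  state : c.state = c'.state
  publicChain : ∀ b, j + b + 1 ∈ c.publicChain ↔ i + b + 1 ∈ c'.publicChain
  attackerChain : ∀ b, j + b + 1 ∈ c.attackerChain ↔ i + b + 1 ∈ c'.attackerChain
  tip : ∃ t, attackerTip c = j + t ∧ attackerTip c' = i + t

lemma Corresponds.step {j i : ℕ} {c c' : Config} (h : Corresponds j i c c') (m : ℕ)
    (x y z : Bool) :
    Corresponds j i (step c (j + m + 1) x y z) (step c' (i + m + 1) x y z) := by
  rcases c with ⟨s, p, a⟩
  rcases c' with ⟨s', p', a'⟩
  obtain ⟨hs, hp, ha, ht⟩ := h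
  obtain rfl : s = s' := hs
  have hn : ∃ t, j + m + 1 = j + t ∧ i + m + 1 = i + t := ⟨m + 1, rfl, rfl⟩
  have e : ∀ b, j + b = j + m ↔ i + b = i + m := by intro b; omega
  simp only at hp ha
  simp only [attackerTip] at ht
  rcases s with (_ | _ | _ | s) | _ | _ <;> cases x <;> cases y <;> cases z <;>
    constructor <;>
    simp only [SelfishMining.step, attackerTip, List.headD_cons, List.mem_cons, hp, ha, e,
      Bool.false_eq_true, if_true, if_false, Nat.add_right_cancel_iff, implies_true] <;>
    assumption

namespace Model

/-- The equality of rewards belongs to the induction: it makes the two games take the same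
withholding decisions, which keeps the configurations in correspondence. -/
lemma config_corresponds {i j : ℕ} {ω : ℕ → Noise S} (h : M.Fresh i j ω) (m : ℕ) :
    Corresponds j i (M.config 0 ω (j + m)) (M.config i (shift j ω) m) ∧
      M.blockReward 0 ω (M.config 0 ω (j + m)) (j + m) =
        M.blockReward i (shift j ω) (M.config i (shift j ω) m) m := by
  have key : ∀ m, Corresponds j i (M.config 0 ω (j + m)) (M.config i (shift j ω) m) →
      M.blockReward 0 ω (M.config 0 ω (j + m)) (j + m) =
        M.blockReward i (shift j ω) (M.config i (shift j ω) m) m := by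
    intro m hm
    obtain ⟨t, ht, ht'⟩ := hm.tip
    -- Only the age of the parent matters, and differences of timestamps are not affected by the
    -- shift.
    simp only [blockReward, ht, ht', zero_add, add_assoc, timestamp_shift i j]
    simp [shift, add_comm]
  suffices H : Corresponds j i (M.config 0 ω (j + m)) (M.config i (shift j ω) m) from
    ⟨H, key m H⟩
  induction m with
  | zero =>
    -- At the start neither game contains a block with a number beyond `j`, respectively `i`, so
    -- both membership conditions compare false statements.
    have h0 := M.config_mem_lt 0 ω j
    have h1 := M.config_mem_lt i (shift j ω) 0
    refine ⟨h.1, fun b => ⟨fun hb => ?_, fun hb => ?_⟩, fun b => ⟨fun hb => ?_, fun hb => ?_⟩,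
      0, h.2, M.attackerTip_config_zero _ _⟩
    · have := h0.1 _ hb; omega
    · have := h1.1 _ hb; omega
    · have := h0.2 _ hb; omega
    · have := h1.2 _ hb; omega
  | succ m ih =>
    have := ih.step m (ω (j + m)).1 (ω (j + m)).2.1
      (by classical exact decide (M.blockReward 0 ω (M.config 0 ω (j + m)) (j + m) ≤ M.β))
    rw [← add_assoc, config, config]
    convert this using 2
    · simp
    · simp [shift, add_comm]
    · simp [shift, add_comm]
    · rw [key m ih]

lemma canonical_shift_iff {i j : ℕ} {ω : ℕ → Noise S} (h : M.Fresh i j ω) (m : ℕ) :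
    M.Canonical 0 ω (j + m + 1) ↔ M.Canonical i (shift j ω) (i + m + 1) := by
  simp only [Canonical]
  conv_lhs => rw [← Filter.map_add_atTop_eq_nat j, Filter.eventually_map]
  refine Filter.eventually_congr (.of_forall fun n => ?_)
  rw [add_comm n j]
  exact (M.config_corresponds h n).1.publicChain m

lemma gain_shift {i j : ℕ} {ω : ℕ → Noise S} (h : M.Fresh i j ω) (m : ℕ) :
    M.gain 0 ω (j + m) = M.gain i (shift j ω) m := by
  have h1 : (shift j ω m) = ω (j + m) := by simp [shift, add_comm]
  have h2 := M.canonical_shift_iff h m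
  rw [gain, gain]
  classical
  refine if_congr ?_ (M.config_corresponds h m).2 rfl
  rw [h1, zero_add, h2]

open scoped Classical in
/-- The gain from block `i + n + 1` if its parent is block `i`. -/
def tipGain (i : ℕ) (ω : ℕ → Noise S) (n : ℕ) : ℝ :=
  if attackerTip (M.config i ω n) = i then M.gain i ω n else 0

open scoped Classical in
lemma gain_eq_sum_tipGain (ω : ℕ → Noise S) (k : ℕ) :
    M.gain 0 ω k = ∑ j ∈ Finset.range (k + 1), ∑ i ∈ Finset.range (j + 1),
      if M.Fresh i j ω then M.tipGain i (shift j ω) (k - j) else 0 := by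
  have hb : attackerTip (M.config 0 ω k) ≤ k := by
    simpa using (M.attackerTip_config_bounds 0 ω k).2
  set b := attackerTip (M.config 0 ω k) with hbdef
  have hkb : b + (k - b) = k := by omega
  obtain ⟨i, hi⟩ := M.exists_fresh (ω := ω) (j := b)
    (M.attackerTip_config_of_le (m := k - b) (by simp) (by rw [hkb]))
  -- Exactly one pair can contribute: `j` is the parent `b` of the new block, and `i` is the state
  -- in which `b` was fresh.
  rw [Finset.sum_eq_single b, Finset.sum_eq_single i, if_pos hi]
  · obtain ⟨t, ht, ht'⟩ := (M.config_corresponds hi (k - b)).1.tip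
    rw [hkb, ← hbdef] at ht
    rw [tipGain, if_pos (by omega), ← M.gain_shift hi, hkb]
  · intro i' _ hne
    refine if_neg fun h' => hne ?_
    have := h'.1.symm.trans hi.1
    simpa using this
  · intro hmem
    exact absurd (Finset.mem_range.2 (Nat.lt_succ_of_le (M.lead_le hi.1))) hmem
  · intro j hj hne
    refine Finset.sum_eq_zero fun i' _ => ?_
    split_ifs with h'
    · have hkj : j + (k - j) = k := by have := Finset.mem_range.1 hj; omega
      obtain ⟨t, ht, ht'⟩ := (M.config_corresponds h' (k - j)).1.tip
      rw [hkj, ← hbdef] at ht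
      rw [tipGain, if_neg (by omega)]
    · rfl
  · intro hmem
    exact absurd (Finset.mem_range.2 (Nat.lt_succ_of_le hb)) hmem

/-- Every attacker block becomes the tip, so an unchanged tip has seen honest blocks only. Each of
them uses up one unit of lead until `race` or `reset` is reached, where any further block replaces
the tip. Thus a tip of State `i` survives at most `i` blocks and `stateReward` is a finite sum. -/
lemma of_attackerTip_config_eq {i : ℕ} {ω : ℕ → Noise S} {m : ℕ}
    (h : attackerTip (M.config i ω m) = i) :
    (∀ k < m, (ω k).1 = false) ∧ m ≤ i ∧
      ∀ s, (M.config i ω m).state = .lead s → m + s = i ∧ (0 < m → 2 ≤ s) := by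
  induction m with
  | zero => simp [config]
  | succ m ih =>
    have h0 : attackerTip (M.config i ω m) = i :=
      M.attackerTip_config_of_le (m := 1) (by omega) h
    obtain ⟨h1, h2, h3⟩ := ih h0
    rw [config] at h ⊢
    suffices H : (ω m).1 = false ∧ m + 1 ≤ i ∧ ∀ s, (step (M.config i ω m) (i + m + 1) (ω m).1
        (ω m).2.1 (by classical exact decide (M.blockReward i ω (M.config i ω m) m ≤ M.β))).state =
          .lead s → m + 1 + s = i ∧ (0 < m + 1 → 2 ≤ s) by
      refine ⟨fun k hk => ?_, H.2⟩
      rcases Nat.lt_succ_iff_lt_or_eq.1 hk with hk | rfl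
      exacts [h1 k hk, H.1]
    revert h h3
    generalize (by classical exact decide (M.blockReward i ω (M.config i ω m) m ≤ M.β)) = z
    generalize M.config i ω m = c at *
    rcases c with ⟨s, p, a⟩
    generalize (ω m).2.1 = y
    cases hx : (ω m).1 <;> rcases s with (_ | _ | _ | s) | _ | _ <;> cases y <;> cases z <;>
      simp +contextual [SelfishMining.step, attackerTip] <;> omega

/-- The absolute reward of block `m` if it is the first block found by the attacker and is found
on the block present at the start. -/
def firstReward (ω : ℕ → Noise S) (m : ℕ) : ℝ :=
  if (∀ k < m, (ω k).1 = false) ∧ (ω m).1 = true then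
    |M.R (∑ k ∈ Finset.range (m + 1), (ω k).2.2.1) (ω m).2.2.2| else 0

lemma firstReward_nonneg (ω : ℕ → Noise S) (m : ℕ) : 0 ≤ M.firstReward ω m := by
  unfold firstReward; split_ifs <;> positivity

lemma tipGain_of_lt {i m : ℕ} (h : i < m) (ω : ℕ → Noise S) : M.tipGain i ω m = 0 :=
  if_neg fun h' => absurd (M.of_attackerTip_config_eq h').2.1 (not_le.2 h)

/-- Dropping the requirement of canonicity gives a bound that does not depend on `i`. -/
lemma abs_tipGain_le (i : ℕ) (ω : ℕ → Noise S) (m : ℕ) :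
    |M.tipGain i ω m| ≤ M.firstReward ω m := by
  rw [tipGain]
  split_ifs with h
  · rw [gain]
    split_ifs with h'
    · rw [firstReward, if_pos ⟨(M.of_attackerTip_config_eq h).1, h'.1⟩, blockReward, h]
      simp [timestamp, add_assoc]
    · simpa using M.firstReward_nonneg ω m
  · simpa using M.firstReward_nonneg ω m

lemma stateReward_eq_sum (i : ℕ) (ω : ℕ → Noise S) :
    M.stateReward i ω = ∑ m ∈ Finset.range (i + 1), M.tipGain i ω m := by
  rw [stateReward]
  refine tsum_eq_sum fun m hm => M.tipGain_of_lt ?_ ω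
  simpa using hm

end Model

end SelfishMining

end

noncomputable section

namespace SelfishMining

open Model

/-! ### Measurability and the Markov property -/

instance : Countable State := by
  refine Function.Injective.countable (β := Option (Option ℕ)) (f := fun s => match s with
    | .lead i => some (some i)
    | .race => some none
    | .reset => none) ?_
  rintro (_ | _ | _) (_ | _ | _) <;> simp

instance : Countable Config := by
  refine Function.Injective.countable (β := State × List ℕ × List ℕ)
    (f := fun c => (c.state, c.publicChain, c.attackerChain)) ?_
  rintro ⟨_, _, _⟩ ⟨_, _, _⟩ h
  simpa using h

instance : MeasurableSpace Config := ⊤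

instance : DiscreteMeasurableSpace Config := ⟨fun _ => trivial⟩

namespace Model

variable {S : Type*} [MeasurableSpace S] (M : Model S)

lemma measurable_timestamp {Ω : Type*} [MeasurableSpace Ω] {X : Ω → ℕ → Noise S} {i n b : ℕ}
    (hX : ∀ k < n, Measurable fun o => X o k) (hb : b ≤ i + n) :
    Measurable fun o => timestamp i (X o) b := by
  unfold timestamp
  refine Finset.measurable_sum _ fun k hk => ?_
  have := hX k (by have := Finset.mem_range.1 hk; omega)
  fun_prop

lemma measurable_blockReward (hR : Measurable (Function.uncurry M.R)) {Ω : Type*}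
    [MeasurableSpace Ω] {X : Ω → ℕ → Noise S} {i n : ℕ}
    (hX : ∀ k < n + 1, Measurable fun o => X o k)
    (hc : Measurable fun o => M.config i (X o) n) :
    Measurable fun o => M.blockReward i (X o) (M.config i (X o) n) n := by
  have h1 : Measurable fun o : Ω => timestamp i (X o) (attackerTip (M.config i (X o) n)) := by
    -- The cap at `i + n` makes the timestamp measurable for every value of the index, since only
    -- the first blocks are known to be measurable; the tip never exceeds the cap.
    have h2 : Measurable fun q : Ω × ℕ => timestamp i (X q.1) (min q.2 (i + n)) :=
      measurable_from_prod_countable_left fun b =>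
        measurable_timestamp hX ((min_le_right b (i + n)).trans (by omega))
    have h3 : Measurable fun o : Ω => attackerTip (M.config i (X o) n) :=
      (Measurable.of_discrete (f := attackerTip)).comp hc
    have h4 := h2.comp (measurable_id.prodMk h3)
    simp only [Function.comp_def, id,
      fun o => min_eq_left (M.attackerTip_config_bounds i (X o) n).2] at h4
    exact h4
  have h4 := measurable_timestamp (i := i) (b := i + n + 1) hX (by omega)
  have h5 := hX n (Nat.lt_succ_self n)
  exact hR.comp ((h4.sub h1).prodMk (by fun_prop))

/-- Stated for an arbitrary source space and with measurability of the first `n` coordinates only,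
so that it also applies to the σ-algebra `past S n`. -/
lemma measurable_config (hR : Measurable (Function.uncurry M.R)) {Ω : Type*}
    [MeasurableSpace Ω] {X : Ω → ℕ → Noise S} {i n : ℕ}
    (hX : ∀ k < n, Measurable fun o => X o k) : Measurable fun o => M.config i (X o) n := by
  classical
  induction n with
  | zero => exact measurable_const
  | succ n ih =>
    have hc := ih fun k hk => hX k (by omega)
    have hb := M.measurable_blockReward hR hX hc
    have hn := hX n (Nat.lt_succ_self n)
    have hs : Measurable fun o => decide (M.blockReward i (X o) (M.config i (X o) n) n ≤ M.β) :=
      measurable_to_bool (by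
        convert measurableSet_le hb (measurable_const (a := M.β)) using 1
        ext; simp)
    exact (Measurable.of_discrete (f := fun q : Config × Bool × Bool × Bool =>
      step q.1 (i + n + 1) q.2.1 q.2.2.1 q.2.2.2)).comp
      (hc.prodMk (hn.fst.prodMk (hn.snd.fst.prodMk hs)))

lemma measurableSet_config (hR : Measurable (Function.uncurry M.R)) {Ω : Type*}
    [MeasurableSpace Ω] {X : Ω → ℕ → Noise S} {i n : ℕ}
    (hX : ∀ k < n, Measurable fun o => X o k) (P : Config → Prop) :
    MeasurableSet {o | P (M.config i (X o) n)} :=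
  M.measurable_config hR hX (MeasurableSet.of_discrete (s := {c | P c}))

lemma measurable_gain (hR : Measurable (Function.uncurry M.R)) (i n : ℕ) :
    Measurable fun ω => M.gain i ω n := by
  classical
  have hX : ∀ k, Measurable fun ω : ℕ → Noise S => ω k := fun k => measurable_pi_apply k
  have hC : MeasurableSet {ω | M.Canonical i ω (i + n + 1)} := by
    simp only [Canonical, eventually_atTop, Set.ofPred_exists, Set.ofPred_forall]
    exact .iUnion fun a => .iInter fun m => .iInter fun _ =>
      M.measurableSet_config hR (fun k _ => hX k) fun c => i + n + 1 ∈ c.publicChain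
  refine Measurable.ite (MeasurableSet.inter ?_ hC)
    (M.measurable_blockReward hR (fun k _ => hX k) (M.measurable_config hR fun k _ => hX k))
    measurable_const
  exact (hX n).fst (measurableSet_singleton true)

lemma measurable_tipGain (hR : Measurable (Function.uncurry M.R)) (i n : ℕ) :
    Measurable fun ω => M.tipGain i ω n := by
  classical
  exact Measurable.ite (M.measurableSet_config hR (fun k _ => measurable_pi_apply k)
    fun c => attackerTip c = i) (M.measurable_gain hR i n) measurable_const

lemma measurable_shift (j : ℕ) : Measurable (shift j : (ℕ → Noise S) → ℕ → Noise S) :=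
  measurable_pi_lambda _ fun n => measurable_pi_apply (n + j)

lemma isProbabilityMeasure_coin {a : ℝ} (h0 : 0 ≤ a) (h1 : a ≤ 1) :
    IsProbabilityMeasure (coin a) := by
  constructor
  simp only [coin, Measure.coe_add, Measure.coe_smul, Pi.add_apply, Pi.smul_apply, measure_univ,
    smul_eq_mul, mul_one]
  rw [← ENNReal.ofReal_add h0 (by linarith)]
  simp

/-- The σ-algebra of the first `j` blocks. -/
abbrev past (S : Type*) [MeasurableSpace S] (j : ℕ) : MeasurableSpace (ℕ → Noise S) :=
  ⨆ k ∈ Set.Iio j, MeasurableSpace.comap (fun ω : ℕ → Noise S => ω k) inferInstance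

lemma past_le (j : ℕ) : past S j ≤ (inferInstance : MeasurableSpace (ℕ → Noise S)) :=
  iSup₂_le fun k _ => (measurable_pi_apply k).comap_le

lemma measurable_past {j k : ℕ} (hk : k < j) : Measurable[past S j] fun ω : ℕ → Noise S => ω k := by
  rw [measurable_iff_comap_le]
  exact le_iSup₂_of_le k hk le_rfl

lemma measurableSet_past_config (hR : Measurable (Function.uncurry M.R)) (j : ℕ)
    (P : Config → Prop) : MeasurableSet[past S j] {ω | P (M.config 0 ω j)} :=
  @measurableSet_config S _ M hR _ (past S j) _ _ _ (fun _ hk => measurable_past hk) P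

/-! ### Independence of past and future -/

section law

variable [IsProbabilityMeasure M.noiseLaw]

instance : IsProbabilityMeasure M.law := by unfold law; infer_instance

lemma measurePreserving_shift (j : ℕ) : MeasurePreserving (shift j) M.law M.law :=
  ⟨measurable_shift j, Measure.map_infinitePi_infinitePi_of_inj (P := fun _ => M.noiseLaw)
    (f := fun n => n + j) (add_left_injective j)⟩

lemma measurePreserving_eval (j : ℕ) : MeasurePreserving (fun ω => ω j) M.law M.noiseLaw :=
  measurePreserving_eval_infinitePi (fun _ => M.noiseLaw) j

lemma indep_past_shift (j : ℕ) :
    Indep (past S j) (MeasurableSpace.comap (shift j) inferInstance) M.law := by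
  have h := iIndepFun_infinitePi (P := fun _ : ℕ => M.noiseLaw) (X := fun _ x => x)
    (fun _ => measurable_id)
  have h' := indep_iSup_of_disjoint (fun k => (measurable_pi_apply k).comap_le) h.iIndep
    (S := Set.Iio j) (T := Set.Ici j) (Set.Iio_disjoint_Ici le_rfl)
  refine indep_of_indep_of_le_right h' ?_
  rw [← measurable_iff_comap_le]
  refine @measurable_pi_lambda _ _ _ (_) _ _ fun n => ?_
  rw [measurable_iff_comap_le]
  exact le_iSup₂_of_le (n + j) (Nat.le_add_left j n) le_rfl

/-- The Markov property. -/
lemma integral_indicator_mul_shift {A : Set (ℕ → Noise S)} {j : ℕ}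
    (hA : MeasurableSet[past S j] A) {g : (ℕ → Noise S) → ℝ} (hg : Measurable g) :
    ∫ ω, A.indicator (fun ω => g (shift j ω)) ω ∂M.law = M.law.real A * ∫ ω, g ω ∂M.law := by
  have hA' : MeasurableSet A := past_le j A hA
  have hI : IndepFun (A.indicator (fun _ => (1 : ℝ))) (fun ω => g (shift j ω)) M.law := by
    rw [IndepFun_iff_Indep]
    refine indep_of_indep_of_le_left (indep_of_indep_of_le_right (M.indep_past_shift j) ?_) ?_
    · rw [← measurable_iff_comap_le]
      exact hg.comp (comap_measurable _)
    · rw [← measurable_iff_comap_le]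
      exact measurable_const.indicator hA
  have h := hI.integral_fun_mul_eq_mul_integral
    (measurable_const.indicator hA').aestronglyMeasurable
    (hg.comp (measurable_shift j)).aestronglyMeasurable
  have h1 : ∫ ω, g (shift j ω) ∂M.law = ∫ ω, g ω ∂M.law := by
    rw [← integral_map (measurable_shift j).aemeasurable hg.aestronglyMeasurable,
      (M.measurePreserving_shift j).map_eq]
  have h2 : ∫ ω, A.indicator (fun _ => (1 : ℝ)) ω ∂M.law = M.law.real A :=
    integral_indicator_one hA'
  rw [h1, h2] at h
  rw [← h]
  congr 1 with ω
  by_cases hω : ω ∈ A <;> simp [hω]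

lemma measureReal_inter_eval {A : Set (ℕ → Noise S)} {j : ℕ}
    (hA : MeasurableSet[past S j] A) {N : Set (Noise S)} (hN : MeasurableSet N) :
    M.law.real (A ∩ {ω | ω j ∈ N}) = M.law.real A * M.noiseLaw.real N := by
  have hA' : MeasurableSet A := past_le j A hA
  have h := (Indep_iff _ _ _).1 (M.indep_past_shift j) A {ω | ω j ∈ N} hA
    ⟨{ω | ω 0 ∈ N}, measurable_pi_apply 0 hN, by ext; simp [shift]⟩
  rw [measureReal_def, h, ENNReal.toReal_mul, measureReal_def, measureReal_def,
    ← (M.measurePreserving_eval j).measure_preimage hN.nullMeasurableSet]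
  rfl

lemma lintegral_eq_lintegral_lintegral_shift {Φ : Noise S → (ℕ → Noise S) → ENNReal}
    (hΦ : Measurable (Function.uncurry Φ)) :
    ∫⁻ ω, Φ (ω 0) (shift 1 ω) ∂M.law = ∫⁻ x, ∫⁻ ω, Φ x ω ∂M.law ∂M.noiseLaw := by
  have hI : IndepFun (fun ω : ℕ → Noise S => ω 0) (shift 1) M.law := by
    rw [IndepFun_iff_Indep]
    refine indep_of_indep_of_le_left (M.indep_past_shift 1) ?_
    rw [← measurable_iff_comap_le]
    exact measurable_past zero_lt_one
  have h := hI.map_prod_eq_prod_map_map (measurable_pi_apply 0).aemeasurable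
    (measurable_shift 1).aemeasurable
  rw [(M.measurePreserving_eval 0).map_eq, (M.measurePreserving_shift 1).map_eq] at h
  change _ = ∫⁻ x, ∫⁻ ω, Function.uncurry Φ (x, ω) ∂M.law ∂M.noiseLaw
  rw [← lintegral_prod (Function.uncurry Φ) hΦ.aemeasurable, ← h,
    lintegral_map hΦ ((measurable_pi_apply 0).prodMk (measurable_shift 1))]
  rfl

end law

end Model

end SelfishMining

end

noncomputable section

namespace SelfishMining

open Model

/-! ### Sums of independent exponential times -/

lemma lintegral_coin (a : ℝ) (φ : Bool → ENNReal) :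
    ∫⁻ b, φ b ∂coin a = ENNReal.ofReal a * φ true + ENNReal.ofReal (1 - a) * φ false := by
  simp [coin]

lemma expMeasure_eq_withDensity (r : ℝ) :
    expMeasure r = volume.withDensity (exponentialPDF r) := rfl

lemma measurable_exponentialPDF (r : ℝ) : Measurable (exponentialPDF r) :=
  (measurable_exponentialPDFReal r).ennreal_ofReal

/-- The density of the sum of `m + 1` independent exponential times of rate `r`. -/
def erlangPDF (r : ℝ) (m : ℕ) (t : ℝ) : ENNReal :=
  ENNReal.ofReal (if 0 ≤ t then r ^ (m + 1) * t ^ m / m.factorial * Real.exp (-(r * t)) else 0)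

lemma measurable_erlangPDF (r : ℝ) (m : ℕ) : Measurable (erlangPDF r m) := by
  refine (Measurable.ite measurableSet_Ici ?_ measurable_const).ennreal_ofReal
  fun_prop

lemma erlangPDF_zero (r : ℝ) : erlangPDF r 0 = exponentialPDF r := by
  ext t
  simp [erlangPDF, exponentialPDF_eq]

lemma lintegral_exponentialPDF_mul_erlangPDF {r : ℝ} (hr : 0 < r) (m : ℕ) (u : ℝ) :
    ∫⁻ x, exponentialPDF r x * erlangPDF r m (u - x) = erlangPDF r (m + 1) u := by
  have h0 : ∀ x, exponentialPDF r x * erlangPDF r m (u - x) = (Set.Icc 0 u).indicator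
      (fun x => ENNReal.ofReal (r ^ (m + 2) / m.factorial * Real.exp (-(r * u)) *
        (u - x) ^ m)) x := by
    intro x
    rw [exponentialPDF_eq, erlangPDF]
    by_cases hx : 0 ≤ x
    · by_cases hux : x ≤ u
      · rw [Set.indicator_of_mem (Set.mem_Icc.2 ⟨hx, hux⟩), if_pos hx, if_pos (sub_nonneg.2 hux),
          ← ENNReal.ofReal_mul (by positivity)]
        congr 1
        have : Real.exp (-(r * u)) = Real.exp (-(r * x)) * Real.exp (-(r * (u - x))) := by
          rw [← Real.exp_add]; ring_nf
        rw [this]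
        ring
      · rw [Set.indicator_of_notMem (fun h => hux h.2), if_neg (fun h => hux (sub_nonneg.1 h))]
        simp
    · rw [Set.indicator_of_notMem (fun h => hx h.1), if_neg hx]
      simp
  simp_rw [h0]
  rw [lintegral_indicator measurableSet_Icc]
  by_cases hu : 0 ≤ u
  · have hc : Continuous fun x => r ^ (m + 2) / m.factorial * Real.exp (-(r * u)) *
        (u - x) ^ m := by fun_prop
    rw [← ofReal_integral_eq_lintegral_ofReal hc.continuousOn.integrableOn_Icc,
      integral_Icc_eq_integral_Ioc, ← intervalIntegral.integral_of_le hu,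
      intervalIntegral.integral_const_mul,
      intervalIntegral.integral_comp_sub_left (fun x => x ^ m), integral_pow, erlangPDF, if_pos hu]
    · congr 1
      have : ((m + 1 : ℝ)) ≠ 0 := by positivity
      have : (m.factorial : ℝ) ≠ 0 := by positivity
      push_cast [Nat.factorial_succ]
      field_simp
      simp
    · rw [EventuallyLE, ae_restrict_iff' measurableSet_Icc]
      refine ae_of_all _ fun x hx => ?_
      have : 0 ≤ u - x := sub_nonneg.2 hx.2
      simp only [Pi.zero_apply]
      positivity
  · rw [Set.Icc_eq_empty hu, erlangPDF, if_neg hu]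
    simp

/-- Adding one more independent exponential time is a convolution of densities. The offset `a` is
the age already reached, as needed by the induction in `lintegral_agedReward`. -/
lemma lintegral_expMeasure_erlangPDF {r : ℝ} (hr : 0 < r) (m : ℕ) {ψ : ℝ → ENNReal}
    (hψ : Measurable ψ) (a : ℝ) :
    ∫⁻ x, (∫⁻ t, erlangPDF r m t * ψ (a + x + t)) ∂expMeasure r =
      ∫⁻ t, erlangPDF r (m + 1) t * ψ (a + t) := by
  have he := measurable_erlangPDF r m
  have hp := measurable_exponentialPDF r
  rw [expMeasure_eq_withDensity, lintegral_withDensity_eq_lintegral_mul _ hp (by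
    refine Measurable.lintegral_prod_right' (f := fun q : ℝ × ℝ => erlangPDF r m q.2 *
      ψ (a + q.1 + q.2)) ?_
    fun_prop)]
  have h1 : ∀ x, (∫⁻ t, erlangPDF r m t * ψ (a + x + t)) =
      ∫⁻ u, erlangPDF r m (u - x) * ψ (a + u) := by
    intro x
    rw [← lintegral_sub_right_eq_self (fun t => erlangPDF r m t * ψ (a + x + t)) x]
    congr 1 with u
    congr 2
    ring
  simp only [Pi.mul_apply, h1]
  have h2 : ∀ x, exponentialPDF r x * ∫⁻ u, erlangPDF r m (u - x) * ψ (a + u) =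
      ∫⁻ u, exponentialPDF r x * (erlangPDF r m (u - x) * ψ (a + u)) := fun x =>
    (lintegral_const_mul _ (by fun_prop)).symm
  simp only [h2]
  rw [lintegral_lintegral_swap (by fun_prop)]
  congr 1 with u
  simp only [← mul_assoc]
  rw [lintegral_mul_const _ (by fun_prop), lintegral_exponentialPDF_mul_erlangPDF hr]

/-- The powers of `a * r * t` sum to an exponential, which lowers the rate from `r` to `(1 - a) *
r`. In probabilistic terms, a geometric number of exponential times has an exponential sum. -/
lemma tsum_pow_mul_erlangPDF {r a : ℝ} (hr : 0 < r) (ha0 : 0 ≤ a) (ha1 : a < 1) (t : ℝ) :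
    ∑' m, ENNReal.ofReal (a ^ m) * erlangPDF r m t =
      ENNReal.ofReal (1 / (1 - a)) * exponentialPDF ((1 - a) * r) t := by
  have h1a : 0 < 1 - a := sub_pos.2 ha1
  rw [exponentialPDF_eq]
  by_cases ht : 0 ≤ t
  · simp only [erlangPDF, if_pos ht]
    have h1 : ∀ m : ℕ, ENNReal.ofReal (a ^ m) * ENNReal.ofReal
        (r ^ (m + 1) * t ^ m / m.factorial * Real.exp (-(r * t))) =
        ENNReal.ofReal (r * Real.exp (-(r * t)) * ((a * r * t) ^ m / m.factorial)) := by
      intro m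
      rw [← ENNReal.ofReal_mul (by positivity)]
      congr 1
      ring
    have h2 : HasSum (fun m : ℕ => (a * r * t) ^ m / m.factorial) (Real.exp (a * r * t)) := by
      rw [Real.exp_eq_exp_ℝ]
      exact NormedSpace.expSeries_div_hasSum_exp (a * r * t)
    have h3 := h2.mul_left (r * Real.exp (-(r * t)))
    simp only [h1]
    rw [← ENNReal.ofReal_tsum_of_nonneg (fun m => by positivity) h3.summable, h3.tsum_eq,
      ← ENNReal.ofReal_mul (by positivity)]
    congr 1
    rw [mul_assoc, ← Real.exp_add]
    field_simp
    congr 1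
    ring
  · simp [erlangPDF, if_neg ht]

/-! ### Moments of the attacker's first block -/

namespace Model

variable {S : Type*} [MeasurableSpace S] (M : Model S)

/-- The absolute reward of the first block found by the attacker, if that is block `m`, when the
block present at the start has age `a`. -/
def agedReward (a : ℝ) (ω : ℕ → Noise S) (m : ℕ) : ENNReal :=
  if (∀ k < m, (ω k).1 = false) ∧ (ω m).1 = true then
    ‖M.R (a + ∑ k ∈ Finset.range (m + 1), (ω k).2.2.1) (ω m).2.2.2‖ₑ else 0

lemma enorm_firstReward (ω : ℕ → Noise S) (m : ℕ) :
    ‖M.firstReward ω m‖ₑ = M.agedReward 0 ω m := by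
  unfold firstReward agedReward
  split_ifs <;> simp

lemma agedReward_zero (a : ℝ) (ω : ℕ → Noise S) :
    M.agedReward a ω 0 = if (ω 0).1 = true then ‖M.R (a + (ω 0).2.2.1) (ω 0).2.2.2‖ₑ else 0 := by
  simp [agedReward]

lemma agedReward_succ (a : ℝ) (ω : ℕ → Noise S) (m : ℕ) :
    M.agedReward a ω (m + 1) =
      if (ω 0).1 = false then M.agedReward (a + (ω 0).2.2.1) (shift 1 ω) m else 0 := by
  have h : (∀ k < m + 1, (ω k).1 = false) ↔
      (ω 0).1 = false ∧ ∀ k < m, (ω (k + 1)).1 = false := by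
    refine ⟨fun h => ⟨h 0 (by omega), fun k hk => h (k + 1) (by omega)⟩, fun h k hk => ?_⟩
    cases k with
    | zero => exact h.1
    | succ k => exact h.2 k (by omega)
  simp only [agedReward, shift, h, and_assoc, Finset.sum_range_succ' _ (m + 1)]
  by_cases h0 : (ω 0).1 = false
  · simp only [h0, true_and, if_true]
    rw [add_comm (∑ k ∈ Finset.range (m + 1), _), add_assoc]
    congr
  · simp [h0]

lemma measurable_agedReward (hR : Measurable (Function.uncurry M.R)) (m : ℕ) :
    Measurable fun q : ℝ × (ℕ → Noise S) => M.agedReward q.1 q.2 m := by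
  have hX : ∀ k, Measurable fun q : ℝ × (ℕ → Noise S) => q.2 k := fun k =>
    (measurable_pi_apply k).comp measurable_snd
  refine Measurable.ite (MeasurableSet.inter ?_ ?_) ?_ measurable_const
  · refine MeasurableSet.congr (MeasurableSet.iInter fun k : ℕ => MeasurableSet.iInter
      fun _ : k < m => (hX k).fst (measurableSet_singleton false)) ?_
    ext
    simp only [Set.mem_iInter]
    exact Iff.rfl
  · exact (hX m).fst (measurableSet_singleton true)
  · refine (hR.comp (Measurable.prodMk ?_ ?_)).enorm
    · exact measurable_fst.add (Finset.measurable_sum _ fun k _ => (hX k).snd.snd.fst)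
    · exact (hX m).snd.snd.snd

lemma measurable_firstReward (hR : Measurable (Function.uncurry M.R)) (m : ℕ) :
    Measurable fun ω => M.firstReward ω m := by
  have hX : ∀ k, Measurable fun ω : ℕ → Noise S => ω k := fun k => measurable_pi_apply k
  refine Measurable.ite (MeasurableSet.inter ?_ ?_) ?_ measurable_const
  · refine MeasurableSet.congr (MeasurableSet.iInter fun k : ℕ => MeasurableSet.iInter
      fun _ : k < m => (hX k).fst (measurableSet_singleton false)) ?_
    ext
    simp only [Set.mem_iInter]
    exact Iff.rfl
  · exact (hX m).fst (measurableSet_singleton true)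
  · have h := hR.comp (Measurable.prodMk (Finset.measurable_sum (Finset.range (m + 1))
      fun k _ => (hX k).snd.snd.fst) (hX m).snd.snd.snd)
    exact measurable_norm.comp h

/-- The assumptions on the parameters of the game. -/
structure Admissible : Prop where
  α_nonneg : 0 ≤ M.α
  α_lt : M.α < 1 / 2
  γ_nonneg : 0 ≤ M.γ
  γ_le : M.γ ≤ 1
  lam_lt : M.lam < 1
  prob : IsProbabilityMeasure M.ν

/-- The ratio of the geometric decay of the states. -/
def ratio : ℝ := M.α / (1 - M.α)

variable {M}

namespace Admissible

lemma rate_pos (h : M.Admissible) : 0 < 1 / (1 - M.lam) := by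
  have := h.lam_lt
  exact div_pos one_pos (by linarith)

lemma one_sub_α_pos (h : M.Admissible) : 0 < 1 - M.α := by have := h.α_lt; linarith

lemma isProb_coin_α (h : M.Admissible) : IsProbabilityMeasure (coin M.α) :=
  isProbabilityMeasure_coin h.α_nonneg (by have := h.α_lt; linarith)

lemma isProb_coin_γ (h : M.Admissible) : IsProbabilityMeasure (coin M.γ) :=
  isProbabilityMeasure_coin h.γ_nonneg h.γ_le

lemma isProb_noise (h : M.Admissible) : IsProbabilityMeasure M.noiseLaw := by
  have := h.isProb_coin_α
  have := h.isProb_coin_γ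
  have := isProbabilityMeasure_expMeasure h.rate_pos
  have := h.prob
  unfold noiseLaw
  infer_instance

lemma lintegral_noise (h : M.Admissible) {φ : Bool → ℝ → S → ENNReal}
    (hφ : ∀ b, Measurable (Function.uncurry (φ b))) :
    ∫⁻ x, φ x.1 x.2.2.1 x.2.2.2 ∂M.noiseLaw =
      ENNReal.ofReal M.α *
        ∫⁻ t, ∫⁻ s, φ true t s ∂M.ν ∂expMeasure (1 / (1 - M.lam)) +
      ENNReal.ofReal (1 - M.α) *
        ∫⁻ t, ∫⁻ s, φ false t s ∂M.ν ∂expMeasure (1 / (1 - M.lam)) := by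
  have := h.isProb_coin_α
  have := h.isProb_coin_γ
  have := isProbabilityMeasure_expMeasure h.rate_pos
  have := h.prob
  have hm : Measurable fun x : Noise S => φ x.1 x.2.2.1 x.2.2.2 := by
    refine measurable_from_prod_countable_right fun b => ?_
    exact (hφ b).comp (measurable_snd.fst.prodMk measurable_snd.snd)
  have hb : ∀ b, ∫⁻ y, φ b y.2.1 y.2.2 ∂(coin M.γ).prod
      ((expMeasure (1 / (1 - M.lam))).prod M.ν) =
      ∫⁻ t, ∫⁻ s, φ b t s ∂M.ν ∂expMeasure (1 / (1 - M.lam)) := by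
    intro b
    rw [lintegral_prod _ (by
      exact ((hφ b).comp (measurable_snd.fst.prodMk measurable_snd.snd)).aemeasurable)]
    simp only [lintegral_const, measure_univ, mul_one]
    exact lintegral_prod _ (hφ b).aemeasurable
  rw [noiseLaw, lintegral_prod _ hm.aemeasurable, lintegral_coin]
  simp only [hb]

/-- Induction on `m` by conditioning on the first block: if it is honest, the remaining game is a
fresh copy in which the parent has aged by the elapsed time. Hence the statement for all `a`. -/
lemma lintegral_agedReward (h : M.Admissible) (hR : Measurable (Function.uncurry M.R)) (m : ℕ) (a : ℝ) :
    ∫⁻ ω, M.agedReward a ω m ∂M.law = ENNReal.ofReal (M.α * (1 - M.α) ^ m) *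
      ∫⁻ t, erlangPDF (1 / (1 - M.lam)) m t * ∫⁻ s, ‖M.R (a + t) s‖ₑ ∂M.ν := by
  have := h.isProb_noise
  have := h.prob
  have hψ : Measurable fun t => ∫⁻ s, ‖M.R t s‖ₑ ∂M.ν := by
    refine Measurable.lintegral_prod_right' (f := fun q : ℝ × S => ‖M.R q.1 q.2‖ₑ) ?_
    exact hR.enorm
  induction m generalizing a with
  | zero =>
    have hm : Measurable (Function.uncurry fun (t : ℝ) (s : S) => ‖M.R (a + t) s‖ₑ) :=
      (hR.comp ((measurable_const.add measurable_fst).prodMk measurable_snd)).enorm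
    have h1 := (M.measurePreserving_eval 0).lintegral_comp (f := fun x : Noise S =>
      if x.1 = true then ‖M.R (a + x.2.2.1) x.2.2.2‖ₑ else 0) (by
        refine Measurable.ite (measurable_fst (measurableSet_singleton true)) ?_ measurable_const
        exact hm.comp (measurable_snd.snd.fst.prodMk measurable_snd.snd.snd))
    simp only [agedReward_zero]
    rw [h1, h.lintegral_noise (φ := fun b t s => if b = true then ‖M.R (a + t) s‖ₑ else 0)]
    · simp only [if_true, Bool.false_eq_true, if_false, lintegral_zero, mul_zero, add_zero,
        pow_zero, mul_one, erlangPDF_zero]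
      rw [expMeasure_eq_withDensity, lintegral_withDensity_eq_lintegral_mul _
        (measurable_exponentialPDF _) (by exact hψ.comp (measurable_const.add measurable_id))]
      rfl
    · rintro (_ | _)
      · exact measurable_const
      · exact hm
  | succ m ih =>
    have hA := M.measurable_agedReward hR m
    simp only [agedReward_succ]
    rw [M.lintegral_eq_lintegral_lintegral_shift (Φ := fun x ω =>
      if x.1 = false then M.agedReward (a + x.2.2.1) ω m else 0)]
    · have h1 : ∀ x : Noise S, ∫⁻ ω, (if x.1 = false then M.agedReward (a + x.2.2.1) ω m else 0)
          ∂M.law = if x.1 = false then ENNReal.ofReal (M.α * (1 - M.α) ^ m) *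
            ∫⁻ t, erlangPDF (1 / (1 - M.lam)) m t *
              ∫⁻ s, ‖M.R (a + x.2.2.1 + t) s‖ₑ ∂M.ν else 0 := by
        intro x
        split_ifs
        · exact ih _
        · simp
      simp only [h1]
      have hI : Measurable fun x : ℝ => ∫⁻ t, erlangPDF (1 / (1 - M.lam)) m t *
              ∫⁻ s, ‖M.R (a + x + t) s‖ₑ ∂M.ν := by
        refine Measurable.lintegral_prod_right' (f := fun q : ℝ × ℝ =>
          erlangPDF (1 / (1 - M.lam)) m q.2 * ∫⁻ s, ‖M.R (a + q.1 + q.2) s‖ₑ ∂M.ν) ?_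
        exact ((measurable_erlangPDF _ m).comp measurable_snd).mul
          (hψ.comp ((measurable_const.add measurable_fst).add measurable_snd))
      rw [h.lintegral_noise (φ := fun b x _ => if b = false then
        ENNReal.ofReal (M.α * (1 - M.α) ^ m) * ∫⁻ t, erlangPDF (1 / (1 - M.lam)) m t *
              ∫⁻ s, ‖M.R (a + x + t) s‖ₑ ∂M.ν else 0)]
      · simp only [if_true, Bool.true_eq_false, if_false, lintegral_zero, mul_zero, zero_add,
          lintegral_const, measure_univ, mul_one]
        rw [lintegral_const_mul _ hI, lintegral_expMeasure_erlangPDF h.rate_pos m hψ a, ← mul_assoc,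
          ← ENNReal.ofReal_mul h.one_sub_α_pos.le]
        congr 2
        ring
      · rintro (_ | _)
        · exact (hI.comp measurable_fst).const_mul _
        · exact measurable_const
    · refine Measurable.ite (measurable_fst.fst (measurableSet_singleton false)) ?_ measurable_const
      exact hA.comp ((measurable_const.add measurable_fst.snd.snd.fst).prodMk measurable_snd)

lemma ratio_nonneg (h : M.Admissible) : 0 ≤ M.ratio := div_nonneg h.α_nonneg h.one_sub_α_pos.le

lemma ratio_lt_one (h : M.Admissible) : M.ratio < 1 := by
  have := h.α_lt
  rw [ratio, div_lt_one h.one_sub_α_pos]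
  linarith

lemma ratio_mul (h : M.Admissible) : M.ratio * (1 - M.α) = M.α :=
  div_mul_cancel₀ _ h.one_sub_α_pos.ne'

/-- Since `ratio * (1 - α) = α`, the weights turn the probabilities `α * (1 - α) ^ m` into `α * α ^
m`, and the Erlang densities sum to a multiple of the density of rate `(1 - α) / (1 - lam)`, for
which the mean is finite by assumption. -/
lemma tsum_lintegral_firstReward_ne_top (h : M.Admissible) (hR : Measurable (Function.uncurry M.R))
    (hint : Integrable (Function.uncurry M.R)
      ((expMeasure ((1 - M.α) / (1 - M.lam))).prod M.ν)) :
    ∑' m, ENNReal.ofReal (M.ratio ^ m) * ∫⁻ ω, ‖M.firstReward ω m‖ₑ ∂M.law ≠ ⊤ := by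
  have := h.prob
  have hψ : Measurable fun t => ∫⁻ s, ‖M.R t s‖ₑ ∂M.ν := by
    refine Measurable.lintegral_prod_right' (f := fun q : ℝ × S => ‖M.R q.1 q.2‖ₑ) ?_
    exact hR.enorm
  have h1 : ∀ m, ENNReal.ofReal (M.ratio ^ m) * ∫⁻ ω, ‖M.firstReward ω m‖ₑ ∂M.law =
      ENNReal.ofReal M.α * ∫⁻ t, (ENNReal.ofReal (M.α ^ m) * erlangPDF (1 / (1 - M.lam)) m t) *
        ∫⁻ s, ‖M.R t s‖ₑ ∂M.ν := by
    intro m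
    have h0 := h.ratio_nonneg
    have h0' := h.α_nonneg
    simp only [enorm_firstReward]
    rw [h.lintegral_agedReward hR, ← mul_assoc, ← ENNReal.ofReal_mul (by positivity)]
    simp only [zero_add, mul_assoc]
    rw [lintegral_const_mul _ (by exact (measurable_erlangPDF _ _).mul hψ),
      ← mul_assoc (ENNReal.ofReal M.α), ← ENNReal.ofReal_mul h0']
    congr 2
    rw [mul_left_comm, ← mul_pow, h.ratio_mul]
  simp only [h1]
  rw [ENNReal.tsum_mul_left, ← lintegral_tsum fun m => by
    exact (((measurable_erlangPDF _ _).const_mul _).mul hψ).aemeasurable]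
  simp only [ENNReal.tsum_mul_right]
  simp only [tsum_pow_mul_erlangPDF h.rate_pos h.α_nonneg (show M.α < 1 by linarith [h.α_lt]),
    mul_assoc]
  rw [lintegral_const_mul _ (by exact (measurable_exponentialPDF _).mul hψ), mul_one_div]
  refine ENNReal.mul_ne_top ENNReal.ofReal_ne_top (ENNReal.mul_ne_top ENNReal.ofReal_ne_top ?_)
  have hr : 0 < (1 - M.α) / (1 - M.lam) := by
    have := h.lam_lt
    exact div_pos h.one_sub_α_pos (by linarith)
  have := isProbabilityMeasure_expMeasure hr
  have h2 := hint.2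
  rw [HasFiniteIntegral, lintegral_prod _ hR.enorm.aemeasurable, expMeasure_eq_withDensity,
    lintegral_withDensity_eq_lintegral_mul _ (measurable_exponentialPDF _) (by exact hψ)] at h2
  exact h2.ne

lemma integrable_firstReward (h : M.Admissible) (hR : Measurable (Function.uncurry M.R))
    (hint : Integrable (Function.uncurry M.R)
      ((expMeasure ((1 - M.α) / (1 - M.lam))).prod M.ν)) (m : ℕ) :
    Integrable (fun ω => M.firstReward ω m) M.law := by
  refine ⟨(M.measurable_firstReward hR m).aestronglyMeasurable, ?_⟩
  rw [HasFiniteIntegral]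
  -- For `α = 0` the weights `ratio ^ m` with `m > 0` vanish and the weighted sum says nothing, but
  -- then `firstReward` has integral zero.
  rcases h.α_nonneg.eq_or_lt with h0 | h0
  · simp only [enorm_firstReward]
    rw [h.lintegral_agedReward hR, ← h0]
    simp
  · have h1 := ENNReal.ne_top_of_tsum_ne_top (h.tsum_lintegral_firstReward_ne_top hR hint) m
    have h2 : 0 < M.ratio := div_pos h0 h.one_sub_α_pos
    refine lt_top_iff_ne_top.2 fun h3 => h1 ?_
    rw [h3, ENNReal.mul_top]
    simpa using pow_pos h2 m

lemma summable_integral_firstReward (h : M.Admissible) (hR : Measurable (Function.uncurry M.R))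
    (hint : Integrable (Function.uncurry M.R)
      ((expMeasure ((1 - M.α) / (1 - M.lam))).prod M.ν)) :
    Summable fun m => M.ratio ^ m * ∫ ω, M.firstReward ω m ∂M.law := by
  have h1 := ENNReal.summable_toReal (h.tsum_lintegral_firstReward_ne_top hR hint)
  refine h1.congr fun m => ?_
  rw [ENNReal.toReal_mul, ENNReal.toReal_ofReal (pow_nonneg h.ratio_nonneg m),
    ← integral_norm_eq_lintegral_enorm (M.measurable_firstReward hR m).aestronglyMeasurable]
  simp only [Real.norm_of_nonneg (M.firstReward_nonneg _ m)]

end Admissible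

end Model

end SelfishMining

end

noncomputable section

namespace SelfishMining

open Model

/-! ### The Markov chain of states -/

lemma integral_expMeasure_one_div {l : ℝ} (hl : l < 1) (g : ℝ → ℝ) :
    ∫ t, g t ∂expMeasure (1 / (1 - l)) =
      ∫ t in Set.Ioi (0 : ℝ), Real.exp (-t / (1 - l)) / (1 - l) * g t := by
  have hl' : 0 < 1 - l := sub_pos.2 hl
  rw [expMeasure_eq_withDensity, integral_withDensity_eq_integral_toReal_smul
    (measurable_exponentialPDF _) (ae_of_all _ fun x => by
      rw [exponentialPDF]; exact ENNReal.ofReal_lt_top),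
    ← integral_Ici_eq_integral_Ioi, ← integral_indicator measurableSet_Ici]
  congr 1 with t
  by_cases ht : 0 ≤ t
  · rw [Set.indicator_of_mem (Set.mem_Ici.2 ht), exponentialPDF_of_nonneg ht,
      ENNReal.toReal_ofReal (by positivity), smul_eq_mul]
    have : -(1 / (1 - l) * t) = -t / (1 - l) := by ring
    rw [this]
    ring
  · rw [Set.indicator_of_notMem (fun h => ht (Set.mem_Ici.1 h)), exponentialPDF_of_neg (not_le.1 ht)]
    simp

lemma integral_id_expMeasure_one_div {l : ℝ} (hl : l < 1) :
    ∫ t, t ∂expMeasure (1 / (1 - l)) = 1 - l := by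
  have hl' : 0 < 1 - l := sub_pos.2 hl
  have h := Real.integral_rpow_mul_exp_neg_mul_Ioi (a := 2) (r := 1 / (1 - l)) two_pos
    (by positivity)
  rw [integral_expMeasure_one_div hl]
  have h1 : ∀ t : ℝ, Real.exp (-t / (1 - l)) / (1 - l) * t =
      1 / (1 - l) * (t ^ ((2 : ℝ) - 1) * Real.exp (-(1 / (1 - l) * t))) := by
    intro t
    have h2 : (2 : ℝ) - 1 = 1 := by norm_num
    have h3 : -(1 / (1 - l) * t) = -t / (1 - l) := by ring
    rw [h2, Real.rpow_one, h3]
    ring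
  simp only [h1]
  rw [integral_const_mul, h, Real.Gamma_two, Real.rpow_two]
  field_simp

/-- The state after one block; `small` says whether the reward of a block found directly after its
parent is at most the cutoff. -/
def nextState : State → (byAttacker small : Bool) → State
  | .lead 0, false, _ => .lead 0
  | .lead 0, true, true => .lead 1
  | .lead 0, true, false => .lead 0
  | .lead (i + 1), true, _ => .lead (i + 2)
  | .lead 1, false, _ => .race
  | .lead 2, false, _ => .reset
  | .lead (i + 3), false, _ => .lead (i + 2)
  | .race, _, _ => .lead 0
  | .reset, _, _ => .lead 0

lemma step_state (c : Config) (k : ℕ) (x y z : Bool) :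
    (step c k x y z).state = nextState c.state x z := by
  rcases c with ⟨s, p, a⟩
  rcases s with (_ | _ | _ | i) | _ | _ <;> cases x <;> cases y <;> cases z <;>
    simp [step, nextState]

lemma nextState_of_ne {s : State} (hs : s ≠ .lead 0) (x z z' : Bool) :
    nextState s x z = nextState s x z' := by
  rcases s with (_ | _ | _ | i) | _ | _ <;> cases x <;> simp [nextState] at hs ⊢

lemma nextState_eq_lead_zero_iff {s : State} {x z : Bool} : nextState s x z = .lead 0 ↔
    (s = .lead 0 ∧ ¬ (x = true ∧ z = true) ∨ s = .race) ∨ s = .reset := by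
  rcases s with (_ | _ | _ | i) | _ | _ <;> cases x <;> cases z <;> simp [nextState]

lemma nextState_eq_lead_one_iff {s : State} {x z : Bool} : nextState s x z = .lead 1 ↔
    s = .lead 0 ∧ x = true ∧ z = true := by
  rcases s with (_ | _ | _ | i) | _ | _ <;> cases x <;> cases z <;> simp [nextState]

lemma nextState_eq_lead_add_two_iff {s : State} {x z : Bool} {i : ℕ} :
    nextState s x z = .lead (i + 2) ↔
      s = .lead (i + 1) ∧ x = true ∨ s = .lead (i + 3) ∧ ¬ x = true := by
  rcases s with (_ | _ | _ | i) | _ | _ <;> cases x <;> cases z <;> simp [nextState]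

lemma nextState_eq_race_iff {s : State} {x z : Bool} : nextState s x z = .race ↔
    s = .lead 1 ∧ ¬ x = true := by
  rcases s with (_ | _ | _ | i) | _ | _ <;> cases x <;> cases z <;> simp [nextState]

lemma nextState_eq_reset_iff {s : State} {x z : Bool} : nextState s x z = .reset ↔
    s = .lead 2 ∧ ¬ x = true := by
  rcases s with (_ | _ | _ | i) | _ | _ <;> cases x <;> cases z <;> simp [nextState]

lemma hasSum_state {g : State → ℝ} {b : ℝ} (h : HasSum (fun i => g (.lead i)) b) :
    HasSum g (b + g .race + g .reset) := by
  have hinj : Function.Injective State.lead := fun a b h => State.lead.inj h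
  have h1 : HasSum (fun s => if s = .race ∨ s = .reset then 0 else g s) b := by
    rw [← hinj.hasSum_iff]
    · simpa [Function.comp_def] using h
    · rintro (i | _ | _) hs
      · exact absurd ⟨i, rfl⟩ hs
      · simp
      · simp
  convert (h1.add (hasSum_ite_eq State.race (g .race))).add
    (hasSum_ite_eq State.reset (g .reset)) using 1
  ext s
  rcases s with i | _ | _ <;> simp

namespace Model

variable {S : Type*} [MeasurableSpace S] (M : Model S)

/-- The mass that the chain moves to a state in one step from the distribution `p`. -/
def inflow (p : State → ℝ) : State → ℝ
  | .lead 0 => p (.lead 0) * (1 - M.withholdProb) + p .race + p .reset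
  | .lead 1 => p (.lead 0) * M.withholdProb
  | .lead (i + 2) => p (.lead (i + 1)) * M.α + p (.lead (i + 3)) * (1 - M.α)
  | .race => p (.lead 1) * (1 - M.α)
  | .reset => p (.lead 2) * (1 - M.α)

lemma hasSum_mul_trans (hw : 1 - M.α + M.publishProb = 1 - M.withholdProb) (p : State → ℝ)
    (s : State) : HasSum (fun s' => p s' * M.trans s' s) (M.inflow p s) := by
  have key : ∀ (t : Finset State), (∀ s' ∉ t, M.trans s' s = 0) →
      ∑ s' ∈ t, p s' * M.trans s' s = M.inflow p s →
      HasSum (fun s' => p s' * M.trans s' s) (M.inflow p s) := by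
    intro t ht hs
    rw [← hs]
    exact hasSum_sum_of_ne_finset_zero fun s' hs' => by rw [ht s' hs', mul_zero]
  rcases s with (_ | _ | i) | _ | _
  · refine key {.lead 0, .race, .reset} ?_ ?_
    · rintro ((_ | _ | _ | k) | _ | _) <;> simp [trans]
    · simp [trans, inflow, hw, add_assoc]
  · refine key {.lead 0} ?_ ?_
    · rintro ((_ | _ | _ | k) | _ | _) <;> simp [trans]
    · simp [trans, inflow]
  · refine key {.lead (i + 1), .lead (i + 3)} ?_ ?_
    · rintro ((_ | _ | _ | k) | _ | _) <;> simp [trans] <;> intros <;>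
        first | omega | (split_ifs <;> first | omega | rfl)
    · rcases i with _ | _ | i <;> simp [trans, inflow]
  · refine key {.lead 1} ?_ ?_
    · rintro ((_ | _ | _ | k) | _ | _) <;> simp [trans]
    · simp [trans, inflow]
  · refine key {.lead 2} ?_ ?_
    · rintro ((_ | _ | _ | k) | _ | _) <;> simp [trans]
    · simp [trans, inflow]

/-- The unnormalized stationary distribution of the chain. -/
def weight : State → ℝ
  | .lead 0 => 1
  | .lead (i + 1) => M.withholdProb * M.ratio ^ i
  | .race => M.withholdProb * (1 - M.α)
  | .reset => M.withholdProb * M.ratio * (1 - M.α)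

/-- The total mass of `weight`. -/
def totalWeight : ℝ :=
  1 + M.withholdProb * (1 - M.ratio)⁻¹ + M.withholdProb * (1 - M.α) +
    M.withholdProb * M.ratio * (1 - M.α)

/-- The probability that the actual game is in State `s` after `j` blocks. -/
def occupation (j : ℕ) (s : State) : ℝ := M.law.real {ω | (M.config 0 ω j).state = s}

variable {M}

namespace Admissible

lemma inflow_weight (h : M.Admissible) (s : State) : M.inflow M.weight s = M.weight s := by
  have hr := h.ratio_mul
  rcases s with (_ | _ | i) | _ | _
  · simp only [inflow, weight]
    linear_combination M.withholdProb * hr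
  · simp [inflow, weight]
  · simp only [inflow, weight]
    linear_combination (-M.withholdProb * M.ratio ^ i) * hr +
      M.withholdProb * M.ratio ^ (i + 1) * hr
  · simp [inflow, weight]
  · simp [inflow, weight]

lemma hasSum_weight (h : M.Admissible) : HasSum M.weight M.totalWeight := by
  have h1 : HasSum (fun i => M.weight (.lead i)) (1 + M.withholdProb * (1 - M.ratio)⁻¹) := by
    rw [add_comm]
    refine (hasSum_nat_add_iff' (f := fun i => M.weight (.lead i)) 1).1 ?_
    simpa [weight] using (hasSum_geometric_of_lt_one h.ratio_nonneg h.ratio_lt_one).mul_left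
      M.withholdProb
  exact hasSum_state h1

/-- A sequence of distributions that is invariant in the limit is proportional to `weight` in the
limit. -/
lemma tendsto_sub_weight (h : M.Admissible) {a : ℕ → State → ℝ}
    (ha : ∀ s, Tendsto (fun n => a n s - M.inflow (a n) s) atTop (𝓝 0)) (s : State) :
    Tendsto (fun n => a n s - M.weight s * a n (.lead 0)) atTop (𝓝 0) := by
  have hα := h.one_sub_α_pos.ne'
  have hr := h.ratio_mul
  have combine : ∀ {x y z : ℕ → ℝ} (c d e : ℝ), Tendsto x atTop (𝓝 0) → Tendsto y atTop (𝓝 0) →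
      Tendsto z atTop (𝓝 0) → Tendsto (fun n => c * x n + d * y n + e * z n) atTop (𝓝 0) := by
    intro x y z c d e hx hy hz
    simpa using ((hx.const_mul c).add (hy.const_mul d)).add (hz.const_mul e)
  have h1 : Tendsto (fun n => a n (.lead 1) - M.weight (.lead 1) * a n (.lead 0)) atTop (𝓝 0) := by
    refine (ha (.lead 1)).congr fun n => ?_
    simp only [inflow, weight]
    ring
  have h2 : Tendsto (fun n => a n (.lead 2) - M.weight (.lead 2) * a n (.lead 0)) atTop (𝓝 0) := by
    -- Adding the balance equations of `lead 0`, `race` and `reset` leaves the flow across a cut: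
    -- what is withheld in State `0` returns through the honest blocks in States `1` and `2`. This
    -- determines State `2`.
    have h3 := combine 1 1 1 (ha (.lead 0)) (ha .race) (ha .reset)
    have h4 := combine (-(1 - M.α)⁻¹) (-1) 0 h3 h1 h3
    refine h4.congr fun n => ?_
    simp only [inflow, weight]
    field_simp
    linear_combination (M.withholdProb * a n (.lead 0)) * hr
  have hl : ∀ i, Tendsto (fun n => a n (.lead (i + 1)) - M.weight (.lead (i + 1)) * a n (.lead 0))
      atTop (𝓝 0) ∧ Tendsto (fun n => a n (.lead (i + 2)) - M.weight (.lead (i + 2)) *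
        a n (.lead 0)) atTop (𝓝 0) := by
    intro i
    induction i with
    | zero => exact ⟨h1, h2⟩
    | succ i ih =>
      refine ⟨ih.2, ?_⟩
      -- The balance equation of `lead (i + 2)`, solved for `lead (i + 3)`.
      have h3 := combine (-(1 - M.α)⁻¹) ((1 - M.α)⁻¹) (-(1 - M.α)⁻¹ * M.α) (ha (.lead (i + 2)))
        ih.2 ih.1
      refine h3.congr fun n => ?_
      simp only [inflow, weight]
      field_simp
      linear_combination (-M.withholdProb * M.ratio ^ i * a n (.lead 0)) * hr +
        (M.withholdProb * M.ratio ^ (i + 1) * a n (.lead 0)) * hr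
  rcases s with (_ | i) | _ | _
  · simp [weight]
  · exact (hl i).1
  · refine (combine 1 (1 - M.α) 0 (ha .race) h1 h1).congr fun n => ?_
    simp only [inflow, weight]
    ring
  · refine (combine 1 (1 - M.α) 0 (ha .reset) h2 h2).congr fun n => ?_
    simp only [inflow, weight]
    ring

/-! ### Transition probabilities of the game -/

lemma noise_byAttacker (h : M.Admissible) : M.noiseLaw.real {x | x.1 = true} = M.α := by
  have := h.isProb_noise
  have := h.prob
  have := isProbabilityMeasure_expMeasure h.rate_pos
  have h1 := h.lintegral_noise (φ := fun b _ _ => if b = true then 1 else 0)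
    (fun b => by cases b <;> exact measurable_const)
  have h2 : MeasurableSet {x : Noise S | x.1 = true} :=
    measurable_fst (measurableSet_singleton true)
  have h3 : ∫⁻ x : Noise S, (if x.1 = true then 1 else 0) ∂M.noiseLaw =
      M.noiseLaw {x | x.1 = true} := by
    rw [← lintegral_indicator_one h2]
    congr 1 with x
    simp [Set.indicator]
  rw [h3] at h1
  rw [measureReal_def, h1]
  simp only [if_true, Bool.false_eq_true, if_false, lintegral_const, measure_univ]
  simp [h.α_nonneg]

lemma noise_small (h : M.Admissible) (hR : Measurable (Function.uncurry M.R)) :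
    M.noiseLaw.real {x | x.1 = true ∧ M.R x.2.2.1 x.2.2.2 ≤ M.β} =
      M.α * ∫ t, M.F t M.β ∂expMeasure (1 / (1 - M.lam)) := by
  have := h.isProb_noise
  have := h.prob
  have := isProbabilityMeasure_expMeasure h.rate_pos
  have hs : MeasurableSet {q : ℝ × S | M.R q.1 q.2 ≤ M.β} := measurableSet_le hR measurable_const
  have h1 := h.lintegral_noise (φ := fun b t s => {q : ℝ × S | b = true ∧
    M.R q.1 q.2 ≤ M.β}.indicator 1 (t, s)) (fun b => by
      refine measurable_one.indicator ?_
      cases b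
      · simp
      · simpa using hs)
  have h2 : MeasurableSet {x : Noise S | x.1 = true ∧ M.R x.2.2.1 x.2.2.2 ≤ M.β} :=
    (measurable_fst (measurableSet_singleton true)).inter
      (hs.preimage (measurable_snd.snd.fst.prodMk measurable_snd.snd.snd))
  have h3 : ∫⁻ x : Noise S, {q : ℝ × S | x.1 = true ∧
      M.R q.1 q.2 ≤ M.β}.indicator 1 (x.2.2.1, x.2.2.2) ∂M.noiseLaw =
      M.noiseLaw {x | x.1 = true ∧ M.R x.2.2.1 x.2.2.2 ≤ M.β} := by
    rw [← lintegral_indicator_one h2]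
    rfl
  have h4 : ∀ t, ∫⁻ s, {q : ℝ × S | true = true ∧ M.R q.1 q.2 ≤ M.β}.indicator 1 (t, s) ∂M.ν =
      M.ν {s | M.R t s ≤ M.β} := by
    intro t
    have h5 : MeasurableSet {s | M.R t s ≤ M.β} :=
      hs.preimage (measurable_const.prodMk measurable_id)
    rw [← lintegral_indicator_one h5]
    congr 1 with s
    simp [Set.indicator]
  rw [h3, lintegral_congr h4] at h1
  rw [measureReal_def, h1]
  simp only [Bool.false_eq_true, false_and, Set.ofPred_false, Set.indicator_empty, lintegral_zero,
    mul_zero, add_zero]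
  rw [ENNReal.toReal_mul, ENNReal.toReal_ofReal h.α_nonneg]
  congr 1
  exact (integral_toReal (measurable_measure_prodMk_left hs).aemeasurable
    (ae_of_all _ fun t => measure_lt_top _ _)).symm

lemma withholdProb_eq (h : M.Admissible) (hR : Measurable (Function.uncurry M.R)) :
    M.withholdProb = M.noiseLaw.real {x | x.1 = true ∧ M.R x.2.2.1 x.2.2.2 ≤ M.β} := by
  rw [h.noise_small hR, integral_expMeasure_one_div h.lam_lt]
  rfl

lemma withholdProb_nonneg (h : M.Admissible) (hR : Measurable (Function.uncurry M.R)) :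
    0 ≤ M.withholdProb := by
  rw [h.withholdProb_eq hR]
  exact measureReal_nonneg

lemma withholdProb_le (h : M.Admissible) (hR : Measurable (Function.uncurry M.R)) :
    M.withholdProb ≤ M.α := by
  have := h.isProb_noise
  rw [h.withholdProb_eq hR]
  refine le_trans ?_ h.noise_byAttacker.le
  exact measureReal_mono fun x hx => hx.1

lemma publishProb_eq (h : M.Admissible) (hR : Measurable (Function.uncurry M.R)) :
    1 - M.α + M.publishProb = 1 - M.withholdProb := by
  have := h.prob
  have := isProbabilityMeasure_expMeasure h.rate_pos
  have hs : MeasurableSet {q : ℝ × S | M.R q.1 q.2 ≤ M.β} := measurableSet_le hR measurable_const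
  have hF : Integrable (fun t => M.F t M.β) (expMeasure (1 / (1 - M.lam))) := by
    refine Integrable.of_bound (C := 1)
      (measurable_measure_prodMk_left hs).ennreal_toReal.aestronglyMeasurable
      (ae_of_all _ fun t => ?_)
    rw [F, Real.norm_of_nonneg measureReal_nonneg]
    exact measureReal_le_one
  rw [withholdProb, publishProb, ← integral_expMeasure_one_div h.lam_lt,
    ← integral_expMeasure_one_div h.lam_lt, integral_sub (integrable_const _) hF, integral_const,
    probReal_univ, one_smul]
  ring

lemma totalWeight_pos (h : M.Admissible) (hR : Measurable (Function.uncurry M.R)) :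
    0 < M.totalWeight := by
  have h1 := h.withholdProb_nonneg hR
  have h2 := h.ratio_nonneg
  have h3 := h.one_sub_α_pos.le
  have h4 : 0 ≤ (1 - M.ratio)⁻¹ := inv_nonneg.2 (sub_nonneg.2 h.ratio_lt_one.le)
  unfold totalWeight
  positivity

lemma weight_nonneg (h : M.Admissible) (hR : Measurable (Function.uncurry M.R)) (s : State) :
    0 ≤ M.weight s := by
  have h1 := h.withholdProb_nonneg hR
  have h2 := h.ratio_nonneg
  have h3 := h.one_sub_α_pos.le
  rcases s with (_ | i) | _ | _ <;> simp only [weight] <;> positivity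

lemma isStationary_weight (h : M.Admissible) (hR : Measurable (Function.uncurry M.R)) :
    M.IsStationary fun s => M.weight s / M.totalWeight where
  nonneg s := div_nonneg (h.weight_nonneg hR s) (h.totalWeight_pos hR).le
  hasSum_one := by
    have := h.hasSum_weight.div_const M.totalWeight
    rwa [div_self (h.totalWeight_pos hR).ne'] at this
  invariant s := by
    have := (M.hasSum_mul_trans (h.publishProb_eq hR) M.weight s).div_const M.totalWeight
    rw [h.inflow_weight] at this
    simpa only [div_mul_eq_mul_div] using this

lemma isStationary_unique (h : M.Admissible) (hR : Measurable (Function.uncurry M.R))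
    {p : State → ℝ} (hp : M.IsStationary p) : p = fun s => M.weight s / M.totalWeight := by
  have hi : ∀ s, M.inflow p s = p s := fun s =>
    (M.hasSum_mul_trans (h.publishProb_eq hR) p s).unique (hp.invariant s)
  have h1 : ∀ s, p s = M.weight s * p (.lead 0) := by
    intro s
    -- A stationary distribution, viewed as a constant sequence, is invariant in the limit.
    have := h.tendsto_sub_weight (a := fun _ => p) (fun s => by simp [hi]) s
    exact sub_eq_zero.1 (tendsto_nhds_unique tendsto_const_nhds this)
  have h2 : HasSum p (M.totalWeight * p (.lead 0)) := by
    have := h.hasSum_weight.mul_right (p (.lead 0))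
    rwa [← funext h1] at this
  have h3 := h2.unique hp.hasSum_one
  have h4 := (h.totalWeight_pos hR).ne'
  ext s
  rw [h1 s, eq_div_iff h4]
  linear_combination M.weight s * h3

/-- The cutoff matters in State `0` only, where the parent has just been found, so its age is the
time of a single block. This is why the state alone is a Markov chain although rewards depend on
older times. -/
lemma state_succ (ω : ℕ → Noise S) (j : ℕ) :
    (M.config 0 ω (j + 1)).state = nextState (M.config 0 ω j).state (ω j).1
      (by classical exact decide (M.R (ω j).2.2.1 (ω j).2.2.2 ≤ M.β)) := by
  rw [config, step_state]
  by_cases h0 : (M.config 0 ω j).state = .lead 0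
  · rw [blockReward, M.attackerTip_of_lead_zero h0]
    simp [timestamp, Finset.sum_range_succ]
  · exact nextState_of_ne h0 _ _ _

lemma measureReal_state_inter (h : M.Admissible) (hR : Measurable (Function.uncurry M.R)) (j : ℕ)
    (s : State) {N : Set (Noise S)} (hN : MeasurableSet N) :
    M.law.real ({ω | (M.config 0 ω j).state = s} ∩ {ω | ω j ∈ N}) =
      M.occupation j s * M.noiseLaw.real N := by
  have := h.isProb_noise
  exact M.measureReal_inter_eval (M.measurableSet_past_config hR j fun c => c.state = s) hN

lemma measurableSet_state (hR : Measurable (Function.uncurry M.R)) (j : ℕ) (s : State) :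
    MeasurableSet {ω | (M.config 0 ω j).state = s} :=
  M.measurableSet_config hR (fun k _ => measurable_pi_apply k) fun c => c.state = s

lemma measurableSet_byAttacker : MeasurableSet {x : Noise S | x.1 = true} :=
  measurable_fst (measurableSet_singleton true)

lemma measurableSet_withheld (hR : Measurable (Function.uncurry M.R)) :
    MeasurableSet {x : Noise S | x.1 = true ∧ M.R x.2.2.1 x.2.2.2 ≤ M.β} :=
  measurableSet_byAttacker.inter ((measurableSet_le hR measurable_const).preimage
      (measurable_snd.snd.fst.prodMk measurable_snd.snd.snd))

lemma occupation_succ (h : M.Admissible) (hR : Measurable (Function.uncurry M.R)) (j : ℕ)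
    (s : State) : M.occupation (j + 1) s = M.inflow (M.occupation j) s := by
  have := h.isProb_noise
  have hW := measurableSet_withheld hR
  have hB : MeasurableSet {x : Noise S | x.1 = true} := measurableSet_byAttacker
  have hBc : M.noiseLaw.real {x | x.1 = true}ᶜ = 1 - M.α := by
    rw [probReal_compl_eq_one_sub hB, h.noise_byAttacker]
  have hWc : M.noiseLaw.real {x | x.1 = true ∧ M.R x.2.2.1 x.2.2.2 ≤ M.β}ᶜ =
      1 - M.withholdProb := by
    rw [probReal_compl_eq_one_sub hW, ← h.withholdProb_eq hR]
  rcases s with (_ | _ | i) | _ | _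
  · rw [inflow, ← hWc, ← h.measureReal_state_inter hR j _ hW.compl, occupation, occupation,
      occupation, ← measureReal_union _ (measurableSet_state hR j _),
      ← measureReal_union _ (measurableSet_state hR j _)]
    · congr 1
      ext ω
      simp only [Set.mem_ofPred_eq, Set.mem_union, Set.mem_inter_iff, Set.mem_compl_iff, state_succ, nextState_eq_lead_zero_iff, decide_eq_true_eq]
    · refine Set.disjoint_left.2 fun ω h1 h2 => ?_
      simp only [Set.mem_union, Set.mem_inter_iff, Set.mem_ofPred_eq] at h1 h2
      rw [h2] at h1
      simp at h1
    · refine Set.disjoint_left.2 fun ω h1 h2 => ?_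
      simp only [Set.mem_inter_iff, Set.mem_ofPred_eq] at h1 h2
      rw [h2] at h1
      simp at h1
  · rw [inflow, h.withholdProb_eq hR, ← h.measureReal_state_inter hR j _ hW, occupation]
    congr 1
    ext ω
    simp only [Set.mem_ofPred_eq, Set.mem_inter_iff, state_succ, zero_add,
      nextState_eq_lead_one_iff, decide_eq_true_eq]
  · rw [inflow, ← hBc]
    conv_rhs => rw [← h.noise_byAttacker]
    rw [← h.measureReal_state_inter hR j _ hB, ← h.measureReal_state_inter hR j _ hB.compl,
      occupation, ← measureReal_union]
    · congr 1
      ext ω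
      simp only [Set.mem_ofPred_eq, Set.mem_union, Set.mem_inter_iff, Set.mem_compl_iff, state_succ, nextState_eq_lead_add_two_iff]
    · refine Set.disjoint_left.2 fun ω h1 h2 => ?_
      simp only [Set.mem_inter_iff, Set.mem_ofPred_eq] at h1 h2
      exact h2.2 h1.2
    · exact (measurableSet_state hR j _).inter (measurable_pi_apply j hB.compl)
  · rw [inflow, ← hBc, ← h.measureReal_state_inter hR j _ hB.compl, occupation]
    congr 1
    ext ω
    simp only [Set.mem_ofPred_eq, Set.mem_inter_iff, Set.mem_compl_iff, state_succ, nextState_eq_race_iff]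
  · rw [inflow, ← hBc, ← h.measureReal_state_inter hR j _ hB.compl, occupation]
    congr 1
    ext ω
    simp only [Set.mem_ofPred_eq, Set.mem_inter_iff, Set.mem_compl_iff, state_succ, nextState_eq_reset_iff]

end Admissible

end Model

end SelfishMining

end

noncomputable section

namespace SelfishMining

open Model

/-! ### Long-run averages -/

lemma abs_sum_div_le {u : ℕ → ℝ} {C : ℝ} (hC : 0 ≤ C) (hu : ∀ j, |u j| ≤ C) {k n : ℕ}
    (hk : k ≤ n) : |(∑ j ∈ Finset.range k, u j) / n| ≤ C := by
  rw [abs_div, Nat.abs_cast]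
  refine div_le_of_le_mul₀ n.cast_nonneg hC ?_
  calc |∑ j ∈ Finset.range k, u j| ≤ ∑ j ∈ Finset.range k, |u j| :=
        Finset.abs_sum_le_sum_abs _ _
    _ ≤ ∑ _j ∈ Finset.range k, C := Finset.sum_le_sum fun j _ => hu j
    _ = k * C := by simp
    _ ≤ C * n := by rw [mul_comm C]; gcongr

/-- Leaving out the last `m` terms does not change a Cesàro limit. -/
lemma tendsto_sum_range_sub_div {u : ℕ → ℝ} {C L : ℝ} (hu : ∀ j, |u j| ≤ C)
    (h : Tendsto (fun n : ℕ => (∑ j ∈ Finset.range n, u j) / n) atTop (𝓝 L)) (m : ℕ) :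
    Tendsto (fun n : ℕ => (∑ j ∈ Finset.range (n - m), u j) / n) atTop (𝓝 L) := by
  have h0 : Tendsto (fun n : ℕ => (∑ j ∈ Finset.range n, u j) / n -
      (∑ j ∈ Finset.range (n - m), u j) / n) atTop (𝓝 0) := by
    refine squeeze_zero_norm' ?_ (tendsto_const_div_atTop_nhds_zero_nat (m * C))
    filter_upwards with n
    rw [← sub_div, Real.norm_eq_abs, abs_div, Nat.abs_cast]
    gcongr
    rw [← Finset.sum_range_add_sum_Ico u (Nat.sub_le n m), add_sub_cancel_left]
    have hC : 0 ≤ C := (abs_nonneg _).trans (hu 0)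
    calc |∑ j ∈ Finset.Ico (n - m) n, u j| ≤ ∑ j ∈ Finset.Ico (n - m) n, |u j| :=
          Finset.abs_sum_le_sum_abs _ _
      _ ≤ ∑ _j ∈ Finset.Ico (n - m) n, C := Finset.sum_le_sum fun j _ => hu j
      _ = ((n - (n - m) : ℕ) : ℝ) * C := by simp
      _ ≤ m * C := by gcongr; omega
  simpa using h.sub h0

namespace Model

variable {S : Type*} [MeasurableSpace S] (M : Model S)

/-- The average of the first `n` occupation probabilities. -/
def average (n : ℕ) (s : State) : ℝ := (∑ j ∈ Finset.range n, M.occupation j s) / n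

/-- The probability that the attacker's tip is fresh after `j` blocks and the state is `i`. -/
def freshProb (i j : ℕ) : ℝ := M.law.real {ω | M.Fresh i j ω}

/-- The expected gain from block `i + m + 1` as a child of block `i`. -/
def meanTipGain (i m : ℕ) : ℝ := ∫ ω, M.tipGain i ω m ∂M.law

/-- The long-run frequency of fresh tips in State `i` for the state frequencies `p`. -/
def freshFreq (p : State → ℝ) : ℕ → ℝ
  | 0 => p (.lead 0)
  | 1 => p (.lead 1)
  | i + 2 => M.α * p (.lead (i + 1))

lemma inflow_average (n : ℕ) (s : State) :
    M.inflow (M.average n) s = (∑ j ∈ Finset.range n, M.inflow (M.occupation j) s) / n := by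
  rcases s with (_ | _ | i) | _ | _ <;>
    simp only [inflow, average, Finset.sum_add_distrib, ← Finset.sum_mul] <;> ring

variable {M}

namespace Admissible

lemma occupation_nonneg (j : ℕ) (s : State) : 0 ≤ M.occupation j s := measureReal_nonneg

lemma occupation_le_one (h : M.Admissible) (j : ℕ) (s : State) : M.occupation j s ≤ 1 := by
  have := h.isProb_noise
  exact measureReal_le_one

/-- The geometric sequence is preserved by the balance equations of the leads from two on, and
`withholdProb ≤ α ≤ ratio` covers State `1`. The bound therefore propagates from the initial State
`0`, uniformly in time. -/
lemma occupation_lead_le (h : M.Admissible) (hR : Measurable (Function.uncurry M.R)) (j i : ℕ) :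
    M.occupation j (.lead i) ≤ M.ratio ^ i := by
  have hr := h.ratio_mul
  have hr0 := h.ratio_nonneg
  have hα := h.α_nonneg
  have hα' := h.one_sub_α_pos.le
  have hαr : M.α ≤ M.ratio := by nlinarith
  induction j generalizing i with
  | zero =>
    cases i with
    | zero => simpa using h.occupation_le_one 0 (.lead 0)
    | succ i =>
      have : M.occupation 0 (.lead (i + 1)) = 0 := by simp [occupation, config]
      rw [this]
      positivity
  | succ j ih =>
    rcases i with _ | _ | i
    · simpa using h.occupation_le_one (j + 1) (.lead 0)
    · rw [h.occupation_succ hR, inflow]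
      have h1 := h.occupation_le_one j (.lead 0)
      have h2 := occupation_nonneg (M := M) j (.lead 0)
      have h3 := h.withholdProb_le hR
      have h4 := h.withholdProb_nonneg hR
      simp only [zero_add, pow_one]
      nlinarith
    · rw [h.occupation_succ hR, inflow]
      calc M.occupation j (.lead (i + 1)) * M.α + M.occupation j (.lead (i + 3)) * (1 - M.α)
          ≤ M.ratio ^ (i + 1) * M.α + M.ratio ^ (i + 3) * (1 - M.α) := by
            gcongr
            · exact ih _
            · exact ih _
        _ = M.ratio ^ (i + 1 + 1) := by
            linear_combination (-M.ratio ^ (i + 1)) * hr + M.ratio ^ (i + 2) * hr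

lemma hasSum_occupation (h : M.Admissible) (hR : Measurable (Function.uncurry M.R)) (j : ℕ) :
    HasSum (M.occupation j) 1 := by
  have := h.isProb_noise
  have h1 : ∑' s, M.law {ω | (M.config 0 ω j).state = s} = 1 := by
    rw [← measure_iUnion _ (measurableSet_state hR j), ← measure_univ (μ := M.law)]
    · congr 1
      ext ω
      simp
    · intro s s' hne
      refine Set.disjoint_left.2 fun ω hs hs' => hne ?_
      simp only [Set.mem_ofPred_eq] at hs hs'
      exact hs.symm.trans hs'
  have h2 := ENNReal.hasSum_toReal (f := fun s => M.law {ω | (M.config 0 ω j).state = s})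
    (by rw [h1]; exact ENNReal.one_ne_top)
  rw [← ENNReal.tsum_toReal_eq (fun _ => measure_ne_top _ _), h1, ENNReal.toReal_one] at h2
  exact h2

lemma abs_occupation_le_one (h : M.Admissible) (j : ℕ) (s : State) : |M.occupation j s| ≤ 1 := by
  rw [abs_of_nonneg (occupation_nonneg j s)]
  exact h.occupation_le_one j s

/-- One step of the chain shifts the averaged terms by one, so the difference telescopes to at most
`1 / n`. -/
lemma tendsto_average_sub_inflow (h : M.Admissible) (hR : Measurable (Function.uncurry M.R))
    (s : State) :
    Tendsto (fun n => M.average n s - M.inflow (M.average n) s) atTop (𝓝 0) := by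
  refine squeeze_zero_norm' ?_ (tendsto_const_div_atTop_nhds_zero_nat 1)
  filter_upwards with n
  rw [inflow_average, average, ← sub_div, Real.norm_eq_abs, abs_div, Nat.abs_cast,
    ← Finset.sum_sub_distrib]
  gcongr
  simp only [← h.occupation_succ hR]
  rw [Finset.sum_range_sub']
  have h1 := h.occupation_le_one 0 s
  have h2 := h.occupation_le_one n s
  have h3 := occupation_nonneg (M := M) 0 s
  have h4 := occupation_nonneg (M := M) n s
  exact abs_le.2 ⟨by linarith, by linarith⟩

/-- The ergodic theorem for the chain. -/
lemma tendsto_average (h : M.Admissible) (hR : Measurable (Function.uncurry M.R)) (s : State) :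
    Tendsto (fun n => M.average n s) atTop (𝓝 (M.weight s / M.totalWeight)) := by
  have hZ := (h.totalWeight_pos hR).ne'
  have hd := h.tendsto_sub_weight (h.tendsto_average_sub_inflow hR)
  -- A summable bound uniform in `n`: no mass escapes to large leads.
  let bound : State → ℝ := fun s => match s with
    | .lead i => M.ratio ^ i
    | .race => 1
    | .reset => 1
  have hb : Summable bound :=
    (hasSum_state (g := bound)
      (hasSum_geometric_of_lt_one h.ratio_nonneg h.ratio_lt_one)).summable
  have hab : ∀ n s, |M.average n s| ≤ bound s := by
    rintro n (i | _ | _)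
    · refine abs_sum_div_le (pow_nonneg h.ratio_nonneg i) (fun j => ?_) le_rfl
      rw [abs_of_nonneg (occupation_nonneg _ _)]
      exact h.occupation_lead_le hR j i
    · exact abs_sum_div_le zero_le_one (fun j => h.abs_occupation_le_one j _) le_rfl
    · exact abs_sum_div_le zero_le_one (fun j => h.abs_occupation_le_one j _) le_rfl
  have h0 : Tendsto (fun n => ∑' s, (M.average n s - M.weight s * M.average n (.lead 0))) atTop
      (𝓝 (∑' _ : State, (0 : ℝ))) := by
    refine tendsto_tsum_of_dominated_convergence (bound := fun s => bound s + M.weight s)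
      (hb.add h.hasSum_weight.summable) hd (.of_forall fun n s => ?_)
    rw [Real.norm_eq_abs]
    refine (abs_sub _ _).trans (add_le_add (hab n s) ?_)
    rw [abs_mul, abs_of_nonneg (h.weight_nonneg hR s)]
    refine mul_le_of_le_one_right (h.weight_nonneg hR s) ?_
    exact abs_sum_div_le zero_le_one (fun j => h.abs_occupation_le_one j _) le_rfl
  rw [tsum_zero] at h0
  -- Each average has total mass one, which identifies the factor of proportionality.
  have h1 : Tendsto (fun n => 1 - M.totalWeight * M.average n (.lead 0)) atTop (𝓝 0) := by
    refine h0.congr' ?_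
    filter_upwards [eventually_gt_atTop 0] with n hn
    have hn' : (n : ℝ) ≠ 0 := by positivity
    have h2 : HasSum (M.average n) 1 := by
      have := (hasSum_sum (s := Finset.range n) fun j _ => h.hasSum_occupation hR j).div_const
        (n : ℝ)
      simp only [Finset.sum_const, Finset.card_range, nsmul_eq_mul, mul_one, div_self hn'] at this
      exact this
    exact (h2.sub (h.hasSum_weight.mul_right _)).tsum_eq
  have h3 : Tendsto (fun n => M.average n (.lead 0)) atTop (𝓝 (1 / M.totalWeight)) := by
    have := (tendsto_const_nhds (x := (1 : ℝ))).sub h1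
    rw [sub_zero] at this
    refine (this.div_const M.totalWeight).congr fun n => ?_
    field_simp
    ring
  have h4 := (hd s).add (h3.const_mul (M.weight s))
  simpa [div_eq_mul_inv] using h4

/-! ### Frequencies of fresh tips -/

lemma freshProb_zero (j : ℕ) : M.freshProb 0 j = M.occupation j (.lead 0) := by
  simp only [freshProb, occupation, fresh_zero_iff]

lemma freshProb_one (j : ℕ) : M.freshProb 1 j = M.occupation j (.lead 1) := by
  simp only [freshProb, occupation, fresh_one_iff]

lemma freshProb_add_two_zero (i : ℕ) : M.freshProb (i + 2) 0 = 0 := by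
  simp [freshProb, not_fresh_add_two_zero]

lemma freshProb_add_two_succ (h : M.Admissible) (hR : Measurable (Function.uncurry M.R))
    (i j : ℕ) : M.freshProb (i + 2) (j + 1) = M.α * M.occupation j (.lead (i + 1)) := by
  rw [mul_comm, ← h.noise_byAttacker, ← h.measureReal_state_inter hR j _ measurableSet_byAttacker]
  simp only [freshProb, fresh_add_two_succ_iff]
  rfl

lemma freshProb_nonneg (i j : ℕ) : 0 ≤ M.freshProb i j := measureReal_nonneg

lemma freshProb_le (h : M.Admissible) (hR : Measurable (Function.uncurry M.R)) (i j : ℕ) :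
    M.freshProb i j ≤ M.ratio ^ i := by
  have hr := h.ratio_mul
  have hr0 := h.ratio_nonneg
  have hα := h.α_nonneg
  have hαr : M.α ≤ M.ratio := by nlinarith
  rcases i with _ | _ | i
  · rw [freshProb_zero]
    exact h.occupation_lead_le hR j 0
  · rw [freshProb_one]
    exact h.occupation_lead_le hR j 1
  · cases j with
    | zero =>
      rw [freshProb_add_two_zero]
      positivity
    | succ j =>
      rw [h.freshProb_add_two_succ hR, pow_succ']
      exact mul_le_mul hαr (h.occupation_lead_le hR j _) (occupation_nonneg _ _) hr0

lemma freshProb_of_lt {i j : ℕ} (hij : j < i) : M.freshProb i j = 0 := by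
  have : {ω | M.Fresh i j ω} = ∅ := by
    ext ω
    simp only [Set.mem_ofPred_eq, Set.mem_empty_iff_false, iff_false]
    exact fun hf => absurd (M.lead_le hf.1) (not_le.2 hij)
  rw [freshProb, this, measureReal_empty]

lemma tendsto_freshProb (h : M.Admissible) (hR : Measurable (Function.uncurry M.R)) (i : ℕ) :
    Tendsto (fun n : ℕ => (∑ j ∈ Finset.range n, M.freshProb i j) / n) atTop
      (𝓝 (M.freshFreq (fun s => M.weight s / M.totalWeight) i)) := by
  rcases i with _ | _ | i
  · simp only [freshProb_zero]
    exact h.tendsto_average hR _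
  · simp only [zero_add, freshProb_one]
    exact h.tendsto_average hR _
  -- A fresh tip after `j + 1` blocks comes from the state after `j` blocks, so one term of the
  -- occupation average is lost.
  · refine ((tendsto_sum_range_sub_div (fun j => h.abs_occupation_le_one j _)
      (h.tendsto_average hR (.lead (i + 1))) 1).const_mul M.α).congr fun n => ?_
    rw [← mul_div_assoc, Finset.mul_sum]
    congr 1
    cases n with
    | zero => simp
    | succ n =>
      rw [Finset.sum_range_succ', freshProb_add_two_zero, add_zero, Nat.add_sub_cancel]
      exact Finset.sum_congr rfl fun j _ => (h.freshProb_add_two_succ hR i j).symm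

/-! ### The expected reward -/

lemma integrable_tipGain (h : M.Admissible) (hR : Measurable (Function.uncurry M.R))
    (hint : Integrable (Function.uncurry M.R)
      ((expMeasure ((1 - M.α) / (1 - M.lam))).prod M.ν)) (i m : ℕ) :
    Integrable (fun ω => M.tipGain i ω m) M.law :=
  (h.integrable_firstReward hR hint m).mono' (M.measurable_tipGain hR i m).aestronglyMeasurable
    (ae_of_all _ fun ω => M.abs_tipGain_le i ω m)

lemma abs_meanTipGain_le (h : M.Admissible) (hR : Measurable (Function.uncurry M.R))
    (hint : Integrable (Function.uncurry M.R)
      ((expMeasure ((1 - M.α) / (1 - M.lam))).prod M.ν)) (i m : ℕ) :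
    |M.meanTipGain i m| ≤ ∫ ω, M.firstReward ω m ∂M.law :=
  norm_integral_le_of_norm_le (f := fun ω => M.tipGain i ω m)
    (h.integrable_firstReward hR hint m) (ae_of_all _ fun ω => M.abs_tipGain_le i ω m)

lemma meanTipGain_of_lt {i m : ℕ} (hm : i < m) : M.meanTipGain i m = 0 := by
  simp [meanTipGain, M.tipGain_of_lt hm]

lemma f_eq_sum (h : M.Admissible) (hR : Measurable (Function.uncurry M.R))
    (hint : Integrable (Function.uncurry M.R)
      ((expMeasure ((1 - M.α) / (1 - M.lam))).prod M.ν)) (i : ℕ) :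
    M.f i = ∑ m ∈ Finset.range (i + 1), M.meanTipGain i m := by
  simp only [f, stateReward_eq_sum]
  exact integral_finsetSum _ fun m _ => h.integrable_tipGain hR hint i m

lemma integrable_stateReward (h : M.Admissible) (hR : Measurable (Function.uncurry M.R))
    (hint : Integrable (Function.uncurry M.R)
      ((expMeasure ((1 - M.α) / (1 - M.lam))).prod M.ν)) (i : ℕ) :
    Integrable (M.stateReward i) M.law := by
  rw [funext (M.stateReward_eq_sum i)]
  exact integrable_finsetSum _ fun m _ => h.integrable_tipGain hR hint i m

lemma gain_eq_sum_indicator (ω : ℕ → Noise S) (k : ℕ) :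
    M.gain 0 ω k = ∑ j ∈ Finset.range (k + 1), ∑ i ∈ Finset.range (j + 1),
      {ω | M.Fresh i j ω}.indicator (fun ω => M.tipGain i (shift j ω) (k - j)) ω := by
  classical
  simp only [M.gain_eq_sum_tipGain, Set.indicator_apply, Set.mem_ofPred_eq]

lemma integrable_indicator_tipGain (h : M.Admissible) (hR : Measurable (Function.uncurry M.R))
    (hint : Integrable (Function.uncurry M.R)
      ((expMeasure ((1 - M.α) / (1 - M.lam))).prod M.ν)) (i j m : ℕ) :
    Integrable ({ω | M.Fresh i j ω}.indicator fun ω => M.tipGain i (shift j ω) m) M.law := by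
  have := h.isProb_noise
  refine Integrable.indicator ?_ (past_le j _ (M.measurableSet_past_config hR j
    fun c => c.state = .lead i ∧ attackerTip c = j))
  exact (M.measurePreserving_shift j).integrable_comp_of_integrable
    (h.integrable_tipGain hR hint i m)

lemma integrable_gain (h : M.Admissible) (hR : Measurable (Function.uncurry M.R))
    (hint : Integrable (Function.uncurry M.R)
      ((expMeasure ((1 - M.α) / (1 - M.lam))).prod M.ν)) (k : ℕ) :
    Integrable (fun ω => M.gain 0 ω k) M.law := by
  simp only [gain_eq_sum_indicator]
  exact integrable_finsetSum _ fun j _ => integrable_finsetSum _ fun i _ =>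
    h.integrable_indicator_tipGain hR hint i j (k - j)

lemma integral_gain (h : M.Admissible) (hR : Measurable (Function.uncurry M.R))
    (hint : Integrable (Function.uncurry M.R)
      ((expMeasure ((1 - M.α) / (1 - M.lam))).prod M.ν)) {k n : ℕ} (hk : k < n) :
    ∫ ω, M.gain 0 ω k ∂M.law = ∑ j ∈ Finset.range (k + 1), ∑ i ∈ Finset.range n,
      M.freshProb i j * M.meanTipGain i (k - j) := by
  have := h.isProb_noise
  simp only [gain_eq_sum_indicator]
  rw [integral_finsetSum _ fun j _ => integrable_finsetSum _ fun i _ =>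
    h.integrable_indicator_tipGain hR hint i j (k - j)]
  refine Finset.sum_congr rfl fun j hj => ?_
  rw [integral_finsetSum _ fun i _ => h.integrable_indicator_tipGain hR hint i j (k - j)]
  -- A lead cannot exceed the number of blocks found. Extending the range of `i` thus adds only
  -- zeros and makes it independent of `j`, ready for exchanging the sums.
  rw [← Finset.sum_subset (Finset.range_subset_range.2 (show j + 1 ≤ n by
    have := Finset.mem_range.1 hj; omega))]
  · refine Finset.sum_congr rfl fun i _ => ?_
    exact M.integral_indicator_mul_shift (M.measurableSet_past_config hR j
      fun c => c.state = .lead i ∧ attackerTip c = j) (M.measurable_tipGain hR i (k - j))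
  · intro i _ hi
    rw [freshProb_of_lt (by simpa using hi), zero_mul]

/-- Regrouping by the state `i` of the parent and the delay `m = k - j`: a child with delay `m` of a
tip fresh after `j` blocks is among the first `n` blocks exactly when `j < n - m`. -/
lemma integral_totalReward (h : M.Admissible) (hR : Measurable (Function.uncurry M.R))
    (hint : Integrable (Function.uncurry M.R)
      ((expMeasure ((1 - M.α) / (1 - M.lam))).prod M.ν)) (n : ℕ) :
    ∫ ω, M.totalReward n ω ∂M.law = ∑ i ∈ Finset.range n, ∑ m ∈ Finset.range (i + 1),
      M.meanTipGain i m * ∑ j ∈ Finset.range (n - m), M.freshProb i j := by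
  simp only [totalReward]
  rw [integral_finsetSum _ fun k _ => h.integrable_gain hR hint k,
    Finset.sum_congr rfl fun k hk => h.integral_gain hR hint (Finset.mem_range.1 hk)]
  calc ∑ k ∈ Finset.range n, ∑ j ∈ Finset.range (k + 1), ∑ i ∈ Finset.range n,
        M.freshProb i j * M.meanTipGain i (k - j)
      = ∑ k ∈ Finset.range n, ∑ m ∈ Finset.range (k + 1), ∑ i ∈ Finset.range n,
        M.freshProb i (k - m) * M.meanTipGain i m := by
        refine Finset.sum_congr rfl fun k _ => ?_
        rw [← Finset.sum_flip]
        refine Finset.sum_congr rfl fun m hm => ?_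
        rw [Nat.sub_sub_self (Nat.lt_succ_iff.1 (Finset.mem_range.1 hm))]
    _ = ∑ m ∈ Finset.range n, ∑ j ∈ Finset.range (n - m), ∑ i ∈ Finset.range n,
        M.freshProb i j * M.meanTipGain i m :=
        Finset.sum_range_diag_flip n fun m j => ∑ i ∈ Finset.range n,
          M.freshProb i j * M.meanTipGain i m
    _ = ∑ m ∈ Finset.range n, ∑ i ∈ Finset.range n,
        M.meanTipGain i m * ∑ j ∈ Finset.range (n - m), M.freshProb i j := by
        refine Finset.sum_congr rfl fun m _ => ?_
        rw [Finset.sum_comm]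
        refine Finset.sum_congr rfl fun i _ => ?_
        rw [Finset.mul_sum]
        exact Finset.sum_congr rfl fun j _ => mul_comm _ _
    _ = ∑ i ∈ Finset.range n, ∑ m ∈ Finset.range n,
        M.meanTipGain i m * ∑ j ∈ Finset.range (n - m), M.freshProb i j := Finset.sum_comm
    _ = _ := by
        refine Finset.sum_congr rfl fun i hi => (Finset.sum_subset
          (Finset.range_subset_range.2 (Finset.mem_range.1 hi)) fun m _ hm => ?_).symm
        rw [meanTipGain_of_lt (by simpa using hm), zero_mul]

/-- Writing `ratio ^ i = ratio ^ m * ratio ^ (i - m)` exhibits the terms as the Cauchy product of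
two summable series. -/
lemma summable_bound (h : M.Admissible) (hR : Measurable (Function.uncurry M.R))
    (hint : Integrable (Function.uncurry M.R)
      ((expMeasure ((1 - M.α) / (1 - M.lam))).prod M.ν)) :
    Summable fun i => ∑ m ∈ Finset.range (i + 1),
      (∫ ω, M.firstReward ω m ∂M.law) * M.ratio ^ i := by
  have h1 := h.summable_integral_firstReward hR hint
  have h2 := summable_geometric_of_lt_one h.ratio_nonneg h.ratio_lt_one
  have h3 := (summable_norm_sum_mul_antidiagonal_of_summable_norm h1.norm h2.norm).of_norm
  refine h3.congr fun i => ?_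
  rw [Finset.Nat.sum_antidiagonal_eq_sum_range_succ
    fun m d => M.ratio ^ m * (∫ ω, M.firstReward ω m ∂M.law) * M.ratio ^ d]
  refine Finset.sum_congr rfl fun m hm => ?_
  have : i = m + (i - m) := by have := Finset.mem_range.1 hm; omega
  conv_rhs => rw [this, pow_add]
  ring

lemma abs_freshFreq_le (h : M.Admissible) (hR : Measurable (Function.uncurry M.R)) (i : ℕ) :
    |M.freshFreq (fun s => M.weight s / M.totalWeight) i| ≤ M.ratio ^ i := by
  refine le_of_tendsto (h.tendsto_freshProb hR i).abs (.of_forall fun n => ?_)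
  refine abs_sum_div_le (pow_nonneg h.ratio_nonneg i) (fun j => ?_) le_rfl
  rw [abs_of_nonneg (freshProb_nonneg i j)]
  exact h.freshProb_le hR i j

lemma summable_f_mul_freshFreq (h : M.Admissible) (hR : Measurable (Function.uncurry M.R))
    (hint : Integrable (Function.uncurry M.R)
      ((expMeasure ((1 - M.α) / (1 - M.lam))).prod M.ν)) :
    Summable fun i => M.f i * M.freshFreq (fun s => M.weight s / M.totalWeight) i := by
  refine Summable.of_norm_bounded (h.summable_bound hR hint) fun i => ?_
  rw [h.f_eq_sum hR hint, Real.norm_eq_abs, abs_mul, ← Finset.sum_mul]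
  refine mul_le_mul ((Finset.abs_sum_le_sum_abs _ _).trans (Finset.sum_le_sum fun m _ =>
    h.abs_meanTipGain_le hR hint i m)) (h.abs_freshFreq_le hR i) (abs_nonneg _) ?_
  exact Finset.sum_nonneg fun m _ => integral_nonneg fun ω => M.firstReward_nonneg ω m

lemma tendsto_integral_totalReward (h : M.Admissible) (hR : Measurable (Function.uncurry M.R))
    (hint : Integrable (Function.uncurry M.R)
      ((expMeasure ((1 - M.α) / (1 - M.lam))).prod M.ν)) :
    Tendsto (fun n : ℕ => (∫ ω, M.totalReward n ω ∂M.law) / n) atTop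
      (𝓝 (∑' i, M.f i * M.freshFreq (fun s => M.weight s / M.totalWeight) i)) := by
  have hq : ∀ i j, |M.freshProb i j| ≤ M.ratio ^ i := by
    intro i j
    rw [abs_of_nonneg (freshProb_nonneg i j)]
    exact h.freshProb_le hR i j
  have h1 : Tendsto (fun n : ℕ => ∑' i, ∑ m ∈ Finset.range (i + 1),
      M.meanTipGain i m * ((∑ j ∈ Finset.range (n - m), M.freshProb i j) / n)) atTop
      (𝓝 (∑' i, M.f i * M.freshFreq (fun s => M.weight s / M.totalWeight) i)) := by
    refine tendsto_tsum_of_dominated_convergence (h.summable_bound hR hint) (fun i => ?_)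
      (.of_forall fun n i => ?_)
    · rw [h.f_eq_sum hR hint, Finset.sum_mul]
      exact tendsto_finsetSum _ fun m _ =>
        (tendsto_sum_range_sub_div (hq i) (h.tendsto_freshProb hR i) m).const_mul _
    · rw [Real.norm_eq_abs]
      refine (Finset.abs_sum_le_sum_abs _ _).trans (Finset.sum_le_sum fun m _ => ?_)
      rw [abs_mul]
      exact mul_le_mul (h.abs_meanTipGain_le hR hint i m)
        (abs_sum_div_le (pow_nonneg h.ratio_nonneg i) (hq i) (Nat.sub_le n m)) (abs_nonneg _)
        (integral_nonneg fun ω => M.firstReward_nonneg ω m)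
  refine h1.congr fun n => ?_
  -- The terms with `i ≥ n` vanish because a lead `i` needs at least `i` blocks, so the series is
  -- the finite sum already computed.
  rw [h.integral_totalReward hR hint, tsum_eq_sum (s := Finset.range n), Finset.sum_div]
  · refine Finset.sum_congr rfl fun i _ => ?_
    rw [Finset.sum_div]
    exact Finset.sum_congr rfl fun m _ => (mul_div_assoc _ _ _).symm
  · intro i hi
    refine Finset.sum_eq_zero fun m _ => ?_
    rw [Finset.sum_eq_zero fun j hj => freshProb_of_lt ?_]
    · simp
    · have h2 := Finset.mem_range.1 hj
      have h3 : n ≤ i := by simpa using hi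
      omega

lemma measurePreserving_time (h : M.Admissible) :
    MeasurePreserving (fun x : Noise S => x.2.2.1) M.noiseLaw (expMeasure (1 / (1 - M.lam))) := by
  have := h.isProb_coin_α
  have := h.isProb_coin_γ
  have := isProbabilityMeasure_expMeasure h.rate_pos
  have := h.prob
  exact measurePreserving_fst.comp (measurePreserving_snd.comp measurePreserving_snd)

lemma integral_timestamp (h : M.Admissible) (n : ℕ) :
    ∫ ω, timestamp 0 ω n ∂M.law = n * (1 - M.lam) := by
  have := h.isProb_noise
  have hl := sub_pos.2 h.lam_lt
  -- The integral of a non-integrable function is zero by convention, so a nonzero mean proves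
  -- integrability.
  have h1 : Integrable (fun t : ℝ => t) (expMeasure (1 / (1 - M.lam))) :=
    .of_integral_ne_zero (by rw [integral_id_expMeasure_one_div h.lam_lt]; exact hl.ne')
  have hp : ∀ j, MeasurePreserving (fun ω : ℕ → Noise S => (ω j).2.2.1) M.law
      (expMeasure (1 / (1 - M.lam))) := fun j =>
    h.measurePreserving_time.comp (M.measurePreserving_eval j)
  simp only [timestamp]
  rw [integral_finsetSum _ fun j _ => by
    exact (hp j).integrable_comp_of_integrable h1]
  have h2 : ∀ j, ∫ ω : ℕ → Noise S, (ω j).2.2.1 ∂M.law = 1 - M.lam := by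
    intro j
    rw [← integral_id_expMeasure_one_div h.lam_lt, ← (hp j).map_eq,
      integral_map (hp j).measurable.aemeasurable (by exact measurable_id.aestronglyMeasurable)]
  simp only [h2, Finset.sum_const, Finset.card_range, nsmul_eq_mul, Nat.sub_zero]

end Admissible

end Model

end SelfishMining

end

theorem mainTheorem1 {S : Type*} [MeasurableSpace S] (M : SelfishMining.Model S)
    (hα₀ : 0 ≤ M.α) (hα₁ : M.α < 1 / 2)
    (hγ₀ : 0 ≤ M.γ) (hγ₁ : M.γ ≤ 1)
    (hlam₀ : 0 ≤ M.lam) (hlam₁ : M.lam < 1)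
    (hν : IsProbabilityMeasure M.ν)
    (hR : Measurable (Function.uncurry M.R))
    (hint : Integrable (Function.uncurry M.R)
      ((expMeasure ((1 - M.α) / (1 - M.lam))).prod M.ν)) :
    (∃! p : SelfishMining.State → ℝ, M.IsStationary p) ∧
    (∀ i, Integrable (M.stateReward i) M.law) ∧
    (∀ n, Integrable (M.totalReward n) M.law) ∧
    ∀ p : SelfishMining.State → ℝ, M.IsStationary p →
      Summable (fun i => M.f (i + 2) * p (.lead (i + 1))) ∧
      -- expected reward per transition of the chain, that is, per block found
      Tendsto (fun n : ℕ => (∫ ω, M.totalReward n ω ∂M.law) / n) atTop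
        (𝓝 (M.f 0 * p (.lead 0) + M.f 1 * p (.lead 1)
          + M.α * ∑' i, M.f (i + 2) * p (.lead (i + 1)))) ∧
      -- the same relative to the expected time that passes, transitions having rate 1 / (1 - lam)
      Tendsto (fun n : ℕ => (∫ ω, M.totalReward n ω ∂M.law) /
          ∫ ω, SelfishMining.Model.timestamp 0 ω n ∂M.law) atTop
        (𝓝 ((M.f 0 * p (.lead 0) + M.f 1 * p (.lead 1)
          + M.α * ∑' i, M.f (i + 2) * p (.lead (i + 1))) / (1 - M.lam))) := by
  have h : M.Admissible := ⟨hα₀, hα₁, hγ₀, hγ₁, hlam₁, hν⟩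
  refine ⟨⟨_, h.isStationary_weight hR, fun p hp => h.isStationary_unique hR hp⟩,
    h.integrable_stateReward hR hint,
    fun n => integrable_finsetSum _ fun k _ => h.integrable_gain hR hint k, fun p hp => ?_⟩
  have hs := h.summable_f_mul_freshFreq hR hint
  have ht := h.tendsto_integral_totalReward hR hint
  -- The factor `α` cannot be cancelled from the summable series when `α = 0`; in that case no block
  -- is ever withheld and all the terms vanish.
  have hw : M.α = 0 → ∀ i, p (.lead (i + 1)) = 0 := by
    intro hα i
    have hw0 : M.withholdProb = 0 :=
      le_antisymm ((h.withholdProb_le hR).trans hα.le) (h.withholdProb_nonneg hR)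
    simp [h.isStationary_unique hR hp, SelfishMining.Model.weight, hw0]
  rw [← h.isStationary_unique hR hp] at hs ht
  have hs2 : Summable fun i => M.α * (M.f (i + 2) * p (.lead (i + 1))) := by
    refine ((summable_nat_add_iff 2).2 hs).congr fun i => ?_
    simp only [SelfishMining.Model.freshFreq]
    ring
  have hV : ∑' i, M.f i * M.freshFreq p i = M.f 0 * p (.lead 0) + M.f 1 * p (.lead 1)
      + M.α * ∑' i, M.f (i + 2) * p (.lead (i + 1)) := by
    rw [← hs.sum_add_tsum_nat_add 2, ← tsum_mul_left]
    simp only [Finset.sum_range_succ, Finset.sum_range_zero, zero_add,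
      SelfishMining.Model.freshFreq]
    congr 2 with i
    ring
  rw [hV] at ht
  refine ⟨?_, ht, ?_⟩
  · by_cases hα : M.α = 0
    · simp only [hw hα, mul_zero]
      exact summable_zero
    · exact (summable_mul_left_iff hα).1 hs2
  · refine (ht.div_const (1 - M.lam)).congr fun n => ?_
    rw [h.integral_timestamp, div_div]
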